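/- Let $A\in\mathbb R^{n\times n}$, $B_f\in\mathbb R^{n\times n_f}$, $C\in\mathbb R^{n_y\times n}$, $D_f\in\mathbb R^{n_y\times n_f}$ with $(A,C)$ observable, let $G(z)=C(zI-A)^{-1}B_f+D_f$, and for an integer $L\ge 0$ let $$\mathcal O_L=\begin{bmatrix}C\\ CA\\ \vdots\\ CA^{L-1}\end{bmatrix},\qquad \mathcal T^f_L=\begin{bmatrix}M_0&&\\ \vdots&\ddots&\\ M_{L-1}&\cdots&M_0\end{bmatrix},\qquad M_0=D_f,\quad M_i=CA^{i-1}B_f\ (i\ge 1),$$ where $\mathcal T^f_L$ is lower triangular block Toeplitz. The system $(A,B_f,C,D_f)$ is called $\tau$-delay left invertible ($\tau\in\mathbb Z_{\ge0}$) if there is a proper rational matrix $G^+_\tau$ with $G^+_\tau(z)G(z)=z^{-\tau}I_{n_f}$ for almost all $z\in\mathbb C$. Assume that it is so for some $\tau$, and let $\tau$ be the smallest such integer. The finite zeros of a rational matrix, counted with multiplicity, are the complex roots of the numerators $\varepsilon_k$ of its Smith–McMillan form $\operatorname{diag}(\varepsilon_k/\psi_k)$; the number of its infinite zeros, counted with multiplicity,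 is $\sum_k\max(\kappa_k,0)$, where $\operatorname{diag}(z^{-\kappa_k})$ is the nonzero part of its Smith–McMillan form at infinity. Let $\zeta=\zeta_{\mathrm{fi}}+\zeta_{\mathrm{inf}}$ be the number of finite and infinite transmission zeros of $(A,B_f,C,D_f)$ counted with multiplicity, where $\zeta_{\mathrm{fi}}$ is the number of finite zeros of the system matrix $\begin{bmatrix}A-zI&B_f\\ C&D_f\end{bmatrix}$ and $\zeta_{\mathrm{inf}}$ is the number of infinite zeros of $G$. If $L\ge\max(\tau,n)$, then $$\dim\mathcal N\big(\begin{bmatrix}\mathcal O_L&\mathcal T^f_L\end{bmatrix}\big)=\zeta .$$ If moreover $(A,B_f)$ is controllable, so that $(A,B_f,C,D_f)$ is a minimal realization of $G$, then the same equality holds when $\zeta_{\mathrm{fi}}$ is instead the number of finite zeros of the transfer function $G$. -/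

import Mathlib

/-- The discrete-time linear time-invariant system `x⁺ = A x + B f`, `y = C x + D f`
with `n` states, `m` inputs and `p` outputs. -/
structure LTISystem (n m p : ℕ) where
  A : Matrix (Fin n) (Fin n) ℝ
  B : Matrix (Fin n) (Fin m) ℝ
  C : Matrix (Fin p) (Fin n) ℝ
  D : Matrix (Fin p) (Fin m) ℝ

/-- The rectangular "diagonal" matrix `diag (d 0, d 1, …)`, padded with zeros. -/
def rectDiag {R : Type*} [Zero R] (a b : ℕ) (d : ℕ → R) : Matrix (Fin a) (Fin b) R :=
  Matrix.of fun i j => if (i : ℕ) = (j : ℕ) then d i else 0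

/-- A real rational matrix is proper if in each entry the degree of the numerator is at most
that of the denominator. -/
def IsProperMatrix {a b : ℕ} (M : Matrix (Fin a) (Fin b) (RatFunc ℝ)) : Prop :=
  ∀ i j, (M i j).intDegree ≤ 0

/-- An invertible rational matrix that is proper together with its inverse. -/
def IsBiproper {a : ℕ} (M : Matrix (Fin a) (Fin a) (RatFunc ℝ)) : Prop :=
  IsUnit M ∧ IsProperMatrix M ∧ IsProperMatrix M⁻¹

/-- A polynomial matrix, seen as a matrix of rational functions. -/
noncomputable def polyToRat {a b : ℕ} (M : Matrix (Fin a) (Fin b) (Polynomial ℝ)) :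
    Matrix (Fin a) (Fin b) (RatFunc ℝ) :=
  M.map (algebraMap (Polynomial ℝ) (RatFunc ℝ))

/-- `M` has rank `r` and Smith–McMillan form `diag (ε₀/ψ₀, …, ε_{r-1}/ψ_{r-1}, 0, …, 0)`:
the `ε k`, `ψ k` are monic and coprime, `ε k ∣ ε (k+1)`, `ψ (k+1) ∣ ψ k`, and `M` is carried to
this form by unimodular polynomial matrices `U` and `V` (for a polynomial matrix `M` all `ψ k`
are `1` and this is the Smith form). -/
def IsSmithMcMillanForm {a b : ℕ} (M : Matrix (Fin a) (Fin b) (RatFunc ℝ))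
    (r : ℕ) (ε ψ : ℕ → Polynomial ℝ) : Prop :=
  r ≤ min a b ∧
  (∀ k < r, (ε k).Monic ∧ (ψ k).Monic ∧ IsCoprime (ε k) (ψ k)) ∧
  (∀ k, k + 1 < r → ε k ∣ ε (k + 1) ∧ ψ (k + 1) ∣ ψ k) ∧
  ∃ (U : Matrix (Fin a) (Fin a) (Polynomial ℝ)) (V : Matrix (Fin b) (Fin b) (Polynomial ℝ)),
    IsUnit U ∧ IsUnit V ∧
    polyToRat U * M * polyToRat V =
      rectDiag a b (fun k => if k < r then
        algebraMap (Polynomial ℝ) (RatFunc ℝ) (ε k) / algebraMap (Polynomial ℝ) (RatFunc ℝ) (ψ k)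
        else 0)

/-- `M` has rank `r` and Smith–McMillan form at infinity
`diag (z^(-κ₀), …, z^(-κ_{r-1}), 0, …, 0)` with `κ₀ ≤ κ₁ ≤ …`. -/
def IsSmithMcMillanFormAtInfinity {a b : ℕ} (M : Matrix (Fin a) (Fin b) (RatFunc ℝ))
    (r : ℕ) (κ : ℕ → ℤ) : Prop :=
  r ≤ min a b ∧
  (∀ k, k + 1 < r → κ k ≤ κ (k + 1)) ∧
  ∃ (U : Matrix (Fin a) (Fin a) (RatFunc ℝ)) (V : Matrix (Fin b) (Fin b) (RatFunc ℝ)),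
    IsBiproper U ∧ IsBiproper V ∧
    U * M * V = rectDiag a b (fun k => if k < r then (RatFunc.X : RatFunc ℝ) ^ (-κ k) else 0)

/-- The rational matrix `M` has exactly `ζ` finite zeros, counted with multiplicity: the zeros are
the complex roots of the numerators in the Smith–McMillan form. -/
def IsNumFiniteZeros {a b : ℕ} (M : Matrix (Fin a) (Fin b) (RatFunc ℝ)) (ζ : ℕ) : Prop :=
  ∃ (r : ℕ) (ε ψ : ℕ → Polynomial ℝ), IsSmithMcMillanForm M r ε ψ ∧
    ζ = (∑ k ∈ Finset.range r, (ε k).aroots ℂ).card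

/-- The rational matrix `M` has exactly `ζ` infinite zeros, counted with multiplicity: a diagonal
entry `z^(-κ)` with `κ > 0` of the Smith–McMillan form at infinity is a zero of multiplicity `κ`
(one with `κ < 0` is a pole). -/
def IsNumInfiniteZeros {a b : ℕ} (M : Matrix (Fin a) (Fin b) (RatFunc ℝ)) (ζ : ℕ) : Prop :=
  ∃ (r : ℕ) (κ : ℕ → ℤ), IsSmithMcMillanFormAtInfinity M r κ ∧
    ζ = ∑ k ∈ Finset.range r, (κ k).toNat

namespace LTISystem

variable {n m p : ℕ}

/-- Markov parameters: `D, C B, C A B, C A² B, …`. -/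
def markov (S : LTISystem n m p) : ℕ → Matrix (Fin p) (Fin m) ℝ
  | 0 => S.D
  | i + 1 => S.C * S.A ^ i * S.B

/-- The extended observability matrix, with block rows `C, C A, …, C A^(L-1)`. -/
def obsMatrix (S : LTISystem n m p) (L : ℕ) : Matrix (Fin L × Fin p) (Fin n) ℝ :=
  Matrix.of fun k j => (S.C * S.A ^ (k.1 : ℕ)) k.2 j

/-- The controllability matrix `[B, A B, …, A^(n-1) B]`. -/
def ctrbMatrix (S : LTISystem n m p) : Matrix (Fin n) (Fin n × Fin m) ℝ :=
  Matrix.of fun i l => (S.A ^ (l.1 : ℕ) * S.B) i l.2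

/-- The lower triangular block Toeplitz matrix of the first `L` Markov parameters. -/
def toeplitzMatrix (S : LTISystem n m p) (L : ℕ) :
    Matrix (Fin L × Fin p) (Fin L × Fin m) ℝ :=
  Matrix.of fun k l => if l.1 ≤ k.1 then S.markov ((k.1 : ℕ) - (l.1 : ℕ)) k.2 l.2 else 0

/-- The pair `(A, C)` is observable. -/
def IsObservable (S : LTISystem n m p) : Prop := (S.obsMatrix n).rank = n

/-- The pair `(A, B)` is controllable. -/
def IsControllable (S : LTISystem n m p) : Prop := S.ctrbMatrix.rank = n

/-- The transfer function `C (z I - A)⁻¹ B + D`. -/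
noncomputable def transferMatrix (S : LTISystem n m p) : Matrix (Fin p) (Fin m) (RatFunc ℝ) :=
  S.C.map RatFunc.C * (Matrix.scalar (Fin n) RatFunc.X - S.A.map RatFunc.C)⁻¹ * S.B.map RatFunc.C
    + S.D.map RatFunc.C

/-- The (Rosenbrock) system matrix `[A - z I, B; C, D]`. -/
noncomputable def systemMatrix (S : LTISystem n m p) :
    Matrix (Fin (n + p)) (Fin (n + m)) (RatFunc ℝ) :=
  Matrix.reindex finSumFinEquiv finSumFinEquiv
    (Matrix.fromBlocks (S.A.map RatFunc.C - Matrix.scalar (Fin n) RatFunc.X) (S.B.map RatFunc.C)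
      (S.C.map RatFunc.C) (S.D.map RatFunc.C))

/-- `t`-delay left invertibility: some proper `H` satisfies `H(z) G(z) = z^(-t) I` (an identity of
rational functions, that is, one that holds at almost all `z`). -/
def IsDelayLeftInvertible (S : LTISystem n m p) (t : ℕ) : Prop :=
  ∃ H : Matrix (Fin m) (Fin p) (RatFunc ℝ), IsProperMatrix H ∧
    H * S.transferMatrix = ((RatFunc.X : RatFunc ℝ)⁻¹ ^ t) • (1 : Matrix (Fin m) (Fin m) (RatFunc ℝ))

/-- The dimension of the null space of `[O_L  T_L]`. -/
noncomputable def obsToeplitzNullity (S : LTISystem n m p) (L : ℕ) : ℕ :=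
  Module.finrank ℝ
    (LinearMap.ker (Matrix.fromCols (S.obsMatrix L) (S.toeplitzMatrix L)).mulVecLin)

end LTISystem

section MatrixAction

/-! ### Matrices over a ring acting on vectors of a module -/

variable {R k M : Type*} [CommRing R] [Field k] [AddCommGroup M] [Module k M]

/-- The action of a matrix over `R` on vectors with entries in `M`, where `R` acts on `M` by
`k`-linear endomorphisms. -/
def matAct (ρ : R →+* Module.End k M) {ι κ : Type*} [Fintype κ] (P : Matrix ι κ R) :
    (κ → M) →ₗ[k] (ι → M) :=
  LinearMap.pi fun i => ∑ j, (ρ (P i j)).comp (LinearMap.proj j)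

variable (ρ : R →+* Module.End k M) {ι κ μ : Type*} [Fintype κ]

theorem matAct_apply (P : Matrix ι κ R) (w : κ → M) (i : ι) :
    matAct ρ P w i = ∑ j, ρ (P i j) (w j) := by
  simp [matAct]

theorem matAct_mul [Fintype μ] (P : Matrix ι κ R) (Q : Matrix κ μ R) (w : μ → M) :
    matAct ρ (P * Q) w = matAct ρ P (matAct ρ Q w) := by
  ext i
  simp only [matAct_apply, Matrix.mul_apply, map_sum, map_mul, LinearMap.sum_apply,
    Module.End.mul_apply]
  exact Finset.sum_comm

theorem matAct_add (P Q : Matrix ι κ R) (w : κ → M) :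
    matAct ρ (P + Q) w = matAct ρ P w + matAct ρ Q w := by
  ext i
  simp [matAct_apply, Finset.sum_add_distrib]

theorem matAct_one [DecidableEq κ] (w : κ → M) :
    matAct ρ (1 : Matrix κ κ R) w = w := by
  ext i
  rw [matAct_apply, Finset.sum_eq_single i]
  · simp
  · intro j _ hj
    simp [Matrix.one_apply_ne' hj]
  · simp

/-- An invertible matrix acts bijectively. -/
noncomputable def matActEquiv [DecidableEq κ] (V : (Matrix κ κ R)ˣ) : (κ → M) ≃ₗ[k] (κ → M) :=
  LinearEquiv.ofLinearMap (matAct ρ (V : Matrix κ κ R)) (matAct ρ (V⁻¹ : (Matrix κ κ R)ˣ).1)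
    (by ext1; ext1; simp [← matAct_mul, matAct_one])
    (by ext1; ext1; simp [← matAct_mul, matAct_one])

/-- `U` acts injectively, so `V` carries the kernel of `U P V` onto that of `P`. Both counts of
zeros pass to a diagonal form by this lemma. -/
theorem finrank_ker_matAct_of_unit_mul_mul_unit [Fintype ι] [DecidableEq κ] [DecidableEq ι]
    (U : (Matrix ι ι R)ˣ) (P : Matrix ι κ R) (V : (Matrix κ κ R)ˣ) :
    Module.finrank k (LinearMap.ker (matAct ρ (U.1 * P * V.1))) =
      Module.finrank k (LinearMap.ker (matAct ρ P)) := by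
  have h : LinearMap.ker (matAct ρ (U.1 * P * V.1)) =
      (LinearMap.ker (matAct ρ P)).map (matActEquiv ρ V).symm.toLinearMap := by
    ext w
    rw [← Submodule.comap_equiv_eq_map_symm]
    simp only [LinearMap.mem_ker, Submodule.mem_comap, matAct_mul]
    exact (matActEquiv ρ U).map_eq_zero_iff
  rw [h]
  exact LinearEquiv.finrank_map_eq _ _

theorem matAct_rectDiag_apply {a b : ℕ} (d : ℕ → R) (w : Fin b → M) (i : Fin a) :
    matAct ρ (rectDiag a b d) w i = if h : (i : ℕ) < b then ρ (d i) (w ⟨i, h⟩) else 0 := by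
  rw [matAct_apply]
  split_ifs with h
  · rw [Finset.sum_eq_single ⟨i, h⟩]
    · simp [rectDiag]
    · intro j _ hj
      have : (i : ℕ) ≠ j := fun e => hj (Fin.ext e.symm)
      simp [rectDiag, this]
    · simp
  · refine Finset.sum_eq_zero fun j _ => ?_
    have : (i : ℕ) ≠ j := by have := j.2; omega
    simp [rectDiag, this]

/-- As `b ≤ a`, every coordinate has its own row, so the kernel is the product of the kernels of the
diagonal entries. -/
theorem finrank_ker_matAct_rectDiag {a b : ℕ} (hab : b ≤ a) (d : ℕ → R)
    (hfin : ∀ i < b, Module.Finite k (LinearMap.ker (ρ (d i)))) :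
    Module.finrank k (LinearMap.ker (matAct ρ (rectDiag a b d))) =
      ∑ i ∈ Finset.range b, Module.finrank k (LinearMap.ker (ρ (d i))) := by
  let e : LinearMap.ker (matAct ρ (rectDiag a b d)) ≃ₗ[k]
      ((i : Fin b) → LinearMap.ker (ρ (d i))) :=
    { toFun := fun w i => ⟨w.1 i, by
        have := congrFun (LinearMap.mem_ker.1 w.2) ⟨i, by omega⟩
        rw [matAct_rectDiag_apply] at this
        simpa using this⟩
      map_add' := fun _ _ => rfl
      map_smul' := fun _ _ => rfl
      invFun := fun v => ⟨fun i => (v i).1, by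
        rw [LinearMap.mem_ker]
        ext i
        rw [matAct_rectDiag_apply]
        split_ifs with h
        · exact (v ⟨i, h⟩).2
        · rfl⟩
      left_inv := fun _ => rfl
      right_inv := fun _ => rfl }
  have := fun i : Fin b => hfin i i.2
  rw [e.finrank_eq, Module.finrank_pi_fintype, Finset.sum_range]

end MatrixAction

/-! ### Polynomials in the shift acting on real sequences -/

section Shift

open Polynomial

/-- The left shift on real sequences. -/
def seqShift : Module.End ℝ (ℕ → ℝ) where
  toFun w k := w (k + 1)
  map_add' _ _ := rfl
  map_smul' _ _ := rfl

/-- Polynomials act on sequences, with `X` acting as the shift. -/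
noncomputable def seqAct : ℝ[X] →+* Module.End ℝ (ℕ → ℝ) := (aeval seqShift).toRingHom

theorem seqAct_X (w : ℕ → ℝ) (k : ℕ) : seqAct X w k = w (k + 1) := by
  simp [seqAct, seqShift]

theorem seqAct_C (a : ℝ) (w : ℕ → ℝ) (k : ℕ) : seqAct (C a) w k = a * w k := by
  simp [seqAct]

theorem seqShift_pow_apply (i : ℕ) (w : ℕ → ℝ) (k : ℕ) : (seqShift ^ i) w k = w (k + i) := by
  induction i generalizing k with
  | zero => simp
  | succ i ih =>
    rw [pow_succ', Module.End.mul_apply]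
    change (seqShift ^ i) w (k + 1) = _
    rw [ih]
    congr 1
    omega

theorem seqAct_apply (p : ℝ[X]) (w : ℕ → ℝ) (k : ℕ) :
    seqAct p w k = ∑ i ∈ Finset.range (p.natDegree + 1), p.coeff i * w (k + i) := by
  simp [seqAct, aeval_eq_sum_range, LinearMap.sum_apply, Finset.sum_apply, seqShift_pow_apply]

/-- The recurrence `p(σ) w = 0` for a monic polynomial `p`. -/
noncomputable def monicRecurrence (p : ℝ[X]) : LinearRecurrence ℝ :=
  ⟨p.natDegree, fun i => -p.coeff i⟩

/-- Monicity lets the top term be solved for, so the equation is a linear recurrence whose solutions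
are fixed by `deg p` free initial values. -/
theorem ker_seqAct {p : ℝ[X]} (hp : p.Monic) :
    LinearMap.ker (seqAct p) = (monicRecurrence p).solSpace := by
  ext w
  rw [LinearMap.mem_ker, ← LinearRecurrence.is_sol_iff_mem_solSpace, funext_iff]
  refine forall_congr' fun k => ?_
  have : p.coeff p.natDegree = 1 := hp
  rw [seqAct_apply, Finset.sum_range_succ, Finset.sum_range (fun i => p.coeff i * w (k + i)), this]
  simp only [one_mul, monicRecurrence, neg_mul, Finset.sum_neg_distrib, Pi.zero_apply]
  rw [add_comm]
  exact add_eq_zero_iff_eq_neg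

theorem finite_ker_seqAct {p : ℝ[X]} (hp : p.Monic) :
    Module.Finite ℝ (LinearMap.ker (seqAct p)) := by
  rw [ker_seqAct hp]
  exact Module.Finite.equiv (monicRecurrence p).toInit.symm

theorem finrank_ker_seqAct {p : ℝ[X]} (hp : p.Monic) :
    Module.finrank ℝ (LinearMap.ker (seqAct p)) = p.natDegree := by
  rw [ker_seqAct hp, (monicRecurrence p).toInit.finrank_eq, Module.finrank_fin_fun]
  rfl

end Shift

/-! ### Smith form and finite zeros -/

section Smith

open Polynomial

theorem polyToRat_mul {a b c : ℕ} (P : Matrix (Fin a) (Fin b) ℝ[X])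
    (Q : Matrix (Fin b) (Fin c) ℝ[X]) : polyToRat (P * Q) = polyToRat P * polyToRat Q :=
  Matrix.map_mul

theorem polyToRat_add {a b : ℕ} (P Q : Matrix (Fin a) (Fin b) ℝ[X]) :
    polyToRat (P + Q) = polyToRat P + polyToRat Q :=
  Matrix.map_add _ (map_add _) _ _

theorem polyToRat_sub {a b : ℕ} (P Q : Matrix (Fin a) (Fin b) ℝ[X]) :
    polyToRat (P - Q) = polyToRat P - polyToRat Q :=
  Matrix.map_sub _ (map_sub _) _ _

theorem polyToRat_one {a : ℕ} : polyToRat (1 : Matrix (Fin a) (Fin a) ℝ[X]) = 1 :=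
  Matrix.map_one _ (map_zero _) (map_one _)

theorem polyToRat_injective {a b : ℕ} :
    Function.Injective (polyToRat : Matrix (Fin a) (Fin b) ℝ[X] → _) :=
  Matrix.map_injective (IsFractionRing.injective ℝ[X] (RatFunc ℝ))

theorem isUnit_polyToRat {a : ℕ} {U : Matrix (Fin a) (Fin a) ℝ[X]} (hU : IsUnit U) :
    IsUnit (polyToRat U) :=
  hU.map (algebraMap ℝ[X] (RatFunc ℝ)).mapMatrix

theorem polyToRat_rectDiag (a b : ℕ) (d : ℕ → ℝ[X]) :
    polyToRat (rectDiag a b d) = rectDiag a b (fun k => algebraMap ℝ[X] (RatFunc ℝ) (d k)) := by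
  ext i j
  simp [polyToRat, rectDiag, apply_ite (algebraMap ℝ[X] (RatFunc ℝ))]

/-- If the columns of `M` are independent, then a diagonal form of `M` has no zero column. -/
theorem le_of_mul_mul_eq_rectDiag {K : Type*} [Field K] {a b r : ℕ}
    {M : Matrix (Fin a) (Fin b) K} (hM : ∀ v, M.mulVec v = 0 → v = 0)
    {U : Matrix (Fin a) (Fin a) K} {V : Matrix (Fin b) (Fin b) K} (hU : IsUnit U) (hV : IsUnit V)
    {d : ℕ → K} (h : U * M * V = rectDiag a b (fun k => if k < r then d k else 0)) : b ≤ r := by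
  by_contra hlt
  rw [not_le] at hlt
  -- Column `r` of the diagonal form is zero, so `V` sends the basis vector `e_r` into the kernel of
  -- `M`.
  have h0 : (U * M * V).mulVec (Pi.single ⟨r, hlt⟩ 1) = 0 := by
    rw [h, Matrix.mulVec_single_one]
    ext i
    simp only [rectDiag, Matrix.col_apply, Matrix.of_apply, Pi.zero_apply]
    split_ifs with h1 h2
    · omega
    · rfl
    · rfl
  rw [← Matrix.mulVec_mulVec, ← Matrix.mulVec_mulVec] at h0
  have h1 := hM _ (Matrix.mulVec_injective_of_isUnit hU (h0.trans (Matrix.mulVec_zero U).symm))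
  have h2 := Matrix.mulVec_injective_of_isUnit hV (h1.trans (Matrix.mulVec_zero V).symm)
  simpa using congrFun h2 ⟨r, hlt⟩

theorem IsSmithMcMillanForm.rank_eq {a b r : ℕ} {M : Matrix (Fin a) (Fin b) (RatFunc ℝ)}
    {ε ψ : ℕ → ℝ[X]} (h : IsSmithMcMillanForm M r ε ψ) (hM : ∀ v, M.mulVec v = 0 → v = 0) :
    r = b := by
  obtain ⟨hr, -, -, U, V, hU, hV, h⟩ := h
  have := le_of_mul_mul_eq_rectDiag hM (isUnit_polyToRat hU) (isUnit_polyToRat hV) h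
  omega

theorem sum_card_aroots {r : ℕ} {ε : ℕ → ℝ[X]} (h : ∀ k < r, (ε k).Monic) :
    (∑ k ∈ Finset.range r, (ε k).aroots ℂ).card = ∑ k ∈ Finset.range r, (ε k).natDegree := by
  rw [Multiset.card_sum]
  refine Finset.sum_congr rfl fun k hk => ?_
  apply IsAlgClosed.card_aroots_eq_natDegree_of_leadingCoeff_ne_zero
  simp [(h k (Finset.mem_range.1 hk)).leadingCoeff]

/-- The dimension of the space of sequences annihilated by a polynomial matrix with the given
diagonal form. -/
theorem finrank_ker_of_smith {a b : ℕ} (hab : b ≤ a) {P : Matrix (Fin a) (Fin b) ℝ[X]}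
    {U : Matrix (Fin a) (Fin a) ℝ[X]} {V : Matrix (Fin b) (Fin b) ℝ[X]}
    (hU : IsUnit U) (hV : IsUnit V) {ε : ℕ → ℝ[X]} (hε : ∀ k < b, (ε k).Monic)
    (h : U * P * V = rectDiag a b ε) :
    Module.finrank ℝ (LinearMap.ker (matAct seqAct P)) =
      ∑ k ∈ Finset.range b, (ε k).natDegree := by
  obtain ⟨U, rfl⟩ := hU
  obtain ⟨V, rfl⟩ := hV
  rw [← finrank_ker_matAct_of_unit_mul_mul_unit seqAct U P V, h,
    finrank_ker_matAct_rectDiag seqAct hab ε fun i hi => finite_ker_seqAct (hε i hi)]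
  exact Finset.sum_congr rfl fun k hk => finrank_ker_seqAct (hε k (Finset.mem_range.1 hk))

theorem rectDiag_congr {R : Type*} [Zero R] {a b : ℕ} {d e : ℕ → R} (h : ∀ k < b, d k = e k) :
    rectDiag a b d = rectDiag a b e := by
  ext i j
  simp only [rectDiag, Matrix.of_apply]
  split_ifs with hij
  · exact h _ (hij ▸ j.2)
  · rfl

/-- The number of finite zeros of a polynomial matrix with independent columns is the dimension
of the space of sequences that it annihilates. -/
theorem IsNumFiniteZeros.eq_finrank_ker {a b : ℕ} {P : Matrix (Fin a) (Fin b) ℝ[X]} {ζ : ℕ}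
    (h : IsNumFiniteZeros (polyToRat P) ζ) (hP : ∀ v, (polyToRat P).mulVec v = 0 → v = 0) :
    ζ = Module.finrank ℝ (LinearMap.ker (matAct seqAct P)) := by
  obtain ⟨r, ε, ψ, hform, rfl⟩ := h
  obtain rfl := hform.rank_eq hP
  obtain ⟨hr, hk, -, U, V, hU, hV, h⟩ := hform
  have hra : r ≤ a := by omega
  rw [sum_card_aroots fun k hlt => (hk k hlt).1]
  refine (finrank_ker_of_smith hra hU hV (fun k hlt => (hk k hlt).1) ?_).symm
  apply polyToRat_injective
  rw [polyToRat_mul, polyToRat_mul, h, polyToRat_rectDiag]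
  refine rectDiag_congr fun k hlt => ?_
  obtain ⟨-, hψ, hco⟩ := hk k hlt
  have hψ0 : algebraMap ℝ[X] (RatFunc ℝ) (ψ k) ≠ 0 := by
    simpa using hψ.ne_zero
  -- `ε k / ψ k` is an entry of the polynomial matrix `U P V`, so `ψ k` divides `ε k`; coprimality
  -- then gives `ψ k = 1`.
  have hdvd : ψ k ∣ ε k := by
    refine ⟨(U * P * V) ⟨k, by omega⟩ ⟨k, hlt⟩, ?_⟩
    apply IsFractionRing.injective ℝ[X] (RatFunc ℝ)
    have := congrFun (congrFun h ⟨k, by omega⟩) ⟨k, hlt⟩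
    rw [← polyToRat_mul, ← polyToRat_mul] at this
    simp only [polyToRat, Matrix.map_apply, rectDiag, Matrix.of_apply, if_true, if_pos hlt] at this
    rw [map_mul, this, mul_div_cancel₀ _ hψ0]
  have h1 : ψ k = 1 := hψ.eq_one_of_isUnit (hco.isUnit_of_dvd' hdvd dvd_rfl)
  simp [h1, hlt]

end Smith

/-! ### Expansion of rational functions at infinity -/

section Expansion

open Polynomial
open scoped PowerSeries

/-- The field of formal Laurent series, in which rational functions are expanded at infinity. -/
abbrev LaurentField := FractionRing ℝ⟦X⟧

/-- The local parameter at infinity, the image of `z⁻¹`. -/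
noncomputable def localParam : LaurentField := algebraMap ℝ⟦X⟧ LaurentField PowerSeries.X

theorem localParam_def : localParam = algebraMap ℝ⟦X⟧ LaurentField PowerSeries.X := rfl

theorem localParam_ne_zero : localParam ≠ 0 := by
  simp [localParam, PowerSeries.X_ne_zero]

/-- The expansion of polynomials at infinity. -/
noncomputable def expandPoly : ℝ[X] →+* LaurentField :=
  eval₂RingHom ((algebraMap ℝ⟦X⟧ LaurentField).comp (PowerSeries.C (R := ℝ))) localParam⁻¹

/-- With `t = 1/z`, `p(z)` is `t ^ (-deg p)` times the reversed polynomial in `t`, which isolates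
the pole at infinity. -/
theorem expandPoly_eq (p : ℝ[X]) :
    expandPoly p = algebraMap ℝ⟦X⟧ LaurentField (p.reverse : ℝ⟦X⟧) *
      localParam⁻¹ ^ p.natDegree := by
  let : Invertible (localParam⁻¹) := invertibleOfNonzero (inv_ne_zero localParam_ne_zero)
  have h := eval₂_reverse_mul_pow
    ((algebraMap ℝ⟦X⟧ LaurentField).comp (PowerSeries.C (R := ℝ))) localParam⁻¹ p
  have h2 : ⅟(localParam⁻¹) = localParam := by rw [invOf_eq_inv, inv_inv]
  rw [h2] at h
  rw [expandPoly, coe_eval₂RingHom, ← h, localParam, ← hom_eval₂, eval₂_C_X_eq_coe]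

theorem expandPoly_injective : Function.Injective expandPoly := by
  rw [injective_iff_map_eq_zero]
  intro p hp
  rw [expandPoly_eq] at hp
  simpa [localParam_ne_zero] using hp

/-- The expansion of rational functions at infinity. -/
noncomputable def expandRat : RatFunc ℝ →+* LaurentField :=
  RatFunc.liftRingHom expandPoly
    (nonZeroDivisors_le_comap_nonZeroDivisors_of_injective _ expandPoly_injective)

theorem expandRat_algebraMap (p : ℝ[X]) :
    expandRat (algebraMap ℝ[X] (RatFunc ℝ) p) = expandPoly p := by
  have := RatFunc.liftRingHom_apply_div expandPoly
    (nonZeroDivisors_le_comap_nonZeroDivisors_of_injective _ expandPoly_injective) p 1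
  rwa [map_one, map_one, div_one, div_one] at this

theorem expandRat_X : expandRat RatFunc.X = localParam⁻¹ := by
  rw [← RatFunc.algebraMap_X, expandRat_algebraMap]
  simp [expandPoly]

theorem expandRat_C (a : ℝ) :
    expandRat (RatFunc.C a) = algebraMap ℝ⟦X⟧ LaurentField (PowerSeries.C a) := by
  rw [← RatFunc.algebraMap_C, expandRat_algebraMap]
  simp [expandPoly]

/-- The reversed denominator has constant coefficient `1`, hence is invertible as a power series;
the remaining power of `t` is the degree excess `e ≥ 0`. -/
theorem exists_powerSeries_of_intDegree_nonpos {g : RatFunc ℝ} (hg : g.intDegree ≤ 0) :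
    ∃ a : ℝ⟦X⟧, expandRat g = algebraMap ℝ⟦X⟧ LaurentField a := by
  have hdeg : g.num.natDegree ≤ g.denom.natDegree := by
    unfold RatFunc.intDegree at hg
    omega
  obtain ⟨e, he⟩ := Nat.exists_eq_add_of_le hdeg
  have hu : IsUnit (g.denom.reverse : ℝ⟦X⟧) := by
    rw [PowerSeries.isUnit_iff_constantCoeff]
    simp [coeff_zero_reverse, g.monic_denom.leadingCoeff]
  obtain ⟨b, hb⟩ := hu.exists_right_inv
  have hb' := congrArg (algebraMap ℝ⟦X⟧ LaurentField) hb
  rw [map_mul, map_one] at hb'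
  refine ⟨(g.num.reverse : ℝ⟦X⟧) * b * PowerSeries.X ^ e, ?_⟩
  have ht := localParam_ne_zero
  have hd : expandPoly g.denom ≠ 0 :=
    fun h => g.denom_ne_zero (expandPoly_injective (h.trans (map_zero _).symm))
  rw [expandRat, RatFunc.liftRingHom_apply, div_eq_iff hd, expandPoly_eq, expandPoly_eq, he,
    map_mul, map_mul, map_pow, ← localParam, pow_add]
  have h1 : localParam ^ e * localParam⁻¹ ^ e = 1 := by
    rw [← mul_pow, mul_inv_cancel₀ ht, one_pow]
  linear_combination (-(algebraMap ℝ⟦X⟧ LaurentField g.num.reverse) *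
    localParam⁻¹ ^ g.num.natDegree) * (hb' * (localParam ^ e * localParam⁻¹ ^ e) + h1)

theorem IsProperMatrix.exists_expansion {a b : ℕ} {M : Matrix (Fin a) (Fin b) (RatFunc ℝ)}
    (hM : IsProperMatrix M) : ∃ N : Matrix (Fin a) (Fin b) ℝ⟦X⟧,
      M.map expandRat = N.map (algebraMap ℝ⟦X⟧ LaurentField) := by
  choose N hN using fun i j => exists_powerSeries_of_intDegree_nonpos (hM i j)
  exact ⟨Matrix.of N, by ext i j; exact hN i j⟩

theorem map_algebraMap_injective {a b : ℕ} : Function.Injective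
    fun M : Matrix (Fin a) (Fin b) ℝ⟦X⟧ => M.map (algebraMap ℝ⟦X⟧ LaurentField) :=
  Matrix.map_injective (IsFractionRing.injective ℝ⟦X⟧ LaurentField)

theorem IsBiproper.exists_expansion {a : ℕ} {M : Matrix (Fin a) (Fin a) (RatFunc ℝ)}
    (hM : IsBiproper M) : ∃ N : (Matrix (Fin a) (Fin a) ℝ⟦X⟧)ˣ,
      M.map expandRat = N.1.map (algebraMap ℝ⟦X⟧ LaurentField) := by
  obtain ⟨hu, h1, h2⟩ := hM
  obtain ⟨N, hN⟩ := h1.exists_expansion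
  obtain ⟨N', hN'⟩ := h2.exists_expansion
  have hdet := (Matrix.isUnit_iff_isUnit_det M).1 hu
  have key : N * N' = 1 := by
    apply map_algebraMap_injective
    change (N * N').map _ = (1 : Matrix _ _ _).map _
    rw [Matrix.map_mul, ← hN, ← hN', ← Matrix.map_mul, Matrix.mul_nonsing_inv M hdet,
      Matrix.map_one _ (map_zero _) (map_one _), Matrix.map_one _ (map_zero _) (map_one _)]
  exact ⟨⟨N, N', key, mul_eq_one_comm.1 key⟩, hN⟩

end Expansion

/-! ### The Markov series and its diagonal form over power series -/

namespace LTISystem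

open scoped PowerSeries

variable {n m p : ℕ}

theorem polyToRat_charmatrix (A : Matrix (Fin n) (Fin n) ℝ) :
    polyToRat A.charmatrix = Matrix.scalar (Fin n) RatFunc.X - A.map RatFunc.C := by
  ext i j
  simp only [polyToRat, Matrix.charmatrix, Matrix.map_apply, Matrix.sub_apply, map_sub,
    Matrix.scalar_apply, Matrix.diagonal_apply, RingHom.mapMatrix_apply]
  split_ifs <;> simp

theorem isUnit_scalar_sub (A : Matrix (Fin n) (Fin n) ℝ) :
    IsUnit (Matrix.scalar (Fin n) RatFunc.X - A.map RatFunc.C) := by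
  rw [← polyToRat_charmatrix, Matrix.isUnit_iff_isUnit_det, isUnit_iff_ne_zero]
  have : (polyToRat A.charmatrix).det = algebraMap _ (RatFunc ℝ) A.charpoly :=
    ((algebraMap _ (RatFunc ℝ)).map_det _).symm
  rw [this]
  simpa using (Matrix.charpoly_monic A).ne_zero

/-- The generating series of the Markov parameters. -/
noncomputable def markovSeries (S : LTISystem n m p) : Matrix (Fin p) (Fin m) ℝ⟦X⟧ :=
  Matrix.of fun i j => PowerSeries.mk fun k => S.markov k i j

/-- The expansion `z⁻¹ + A z⁻² + ⋯` of the resolvent at infinity. -/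
noncomputable def resolventSeries (A : Matrix (Fin n) (Fin n) ℝ) : Matrix (Fin n) (Fin n) ℝ⟦X⟧ :=
  Matrix.of fun i j => PowerSeries.X * PowerSeries.mk fun k => (A ^ k) i j

theorem resolventSeries_spec (A : Matrix (Fin n) (Fin n) ℝ) :
    (1 - (PowerSeries.X : ℝ⟦X⟧) • A.map PowerSeries.C) * resolventSeries A =
      (PowerSeries.X : ℝ⟦X⟧) • 1 := by
  rw [sub_mul, one_mul, sub_eq_iff_eq_add]
  ext i j k
  simp only [resolventSeries, Matrix.of_apply, Matrix.add_apply, Matrix.smul_apply, smul_eq_mul,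
    Matrix.smul_mul, map_add, Matrix.mul_apply, Matrix.map_apply]
  cases k with
  | zero => simp
  | succ k =>
    rw [PowerSeries.coeff_succ_X_mul, PowerSeries.coeff_succ_X_mul, PowerSeries.coeff_succ_X_mul,
      PowerSeries.coeff_mk]
    cases k with
    | zero => simp [Matrix.one_apply, apply_ite, mul_left_comm]
    | succ k =>
      rw [pow_succ', Matrix.mul_apply]
      simp [Matrix.one_apply, apply_ite, PowerSeries.coeff_succ_X_mul, PowerSeries.coeff_one]

theorem markovSeries_eq (S : LTISystem n m p) :
    S.markovSeries = S.C.map PowerSeries.C * resolventSeries S.A * S.B.map PowerSeries.C +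
      S.D.map PowerSeries.C := by
  ext i j k
  simp only [markovSeries, resolventSeries, Matrix.of_apply, Matrix.add_apply, map_add,
    Matrix.mul_apply, Matrix.map_apply, PowerSeries.coeff_mk, map_sum,
    PowerSeries.coeff_mul_C, Finset.sum_mul, PowerSeries.coeff_C_mul]
  cases k with
  | zero => simp [markov]
  | succ k => simp [markov, PowerSeries.coeff_succ_X_mul, Matrix.mul_apply, Finset.sum_mul]

/-- Since `t (z - A) = 1 - t A`, the geometric series `resolventSeries` is the expansion of `(z -
A)⁻¹`. -/
theorem map_expandRat_transferMatrix (S : LTISystem n m p) :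
    S.transferMatrix.map expandRat = S.markovSeries.map (algebraMap ℝ⟦X⟧ LaurentField) := by
  have hC {a b : ℕ} (M : Matrix (Fin a) (Fin b) ℝ) : (M.map RatFunc.C).map expandRat =
      (M.map (PowerSeries.C (R := ℝ))).map (algebraMap ℝ⟦X⟧ LaurentField) := by
    ext i j
    simp [expandRat_C]
  set Z := Matrix.scalar (Fin n) RatFunc.X - S.A.map RatFunc.C with hZ
  have h1 : Z⁻¹.map expandRat * Z.map expandRat = 1 := by
    rw [← Matrix.map_mul, Matrix.nonsing_inv_mul _
      ((Matrix.isUnit_iff_isUnit_det _).1 (isUnit_scalar_sub S.A)),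
      Matrix.map_one _ (map_zero _) (map_one _)]
  have h2 : Z.map expandRat * (resolventSeries S.A).map (algebraMap ℝ⟦X⟧ LaurentField) = 1 := by
    have h3 : localParam • Z.map expandRat =
        (1 - (PowerSeries.X : ℝ⟦X⟧) • S.A.map PowerSeries.C).map
          (algebraMap ℝ⟦X⟧ LaurentField) := by
      ext i j
      simp only [hZ, Matrix.smul_apply, Matrix.map_apply, Matrix.sub_apply, map_sub, expandRat_C,
        smul_eq_mul, mul_sub, map_mul, Matrix.scalar_apply, Matrix.diagonal_apply,
        Matrix.one_apply]
      split_ifs <;> simp [expandRat_X, localParam_ne_zero, ← localParam_def]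
    apply smul_right_injective _ localParam_ne_zero
    change localParam • _ = localParam • _
    rw [← Matrix.smul_mul, h3, ← Matrix.map_mul, resolventSeries_spec]
    ext i j
    simp only [localParam, Matrix.one_apply, Matrix.smul_apply, Matrix.map_apply, smul_eq_mul]
    split_ifs <;> simp
  rw [transferMatrix, markovSeries_eq, Matrix.map_add _ (map_add _), Matrix.map_add _ (map_add _),
    Matrix.map_mul, Matrix.map_mul, Matrix.map_mul, Matrix.map_mul, hC, hC, hC,
    left_inv_eq_right_inv h1 h2]

theorem IsDelayLeftInvertible.exists_series {S : LTISystem n m p} {t : ℕ}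
    (h : S.IsDelayLeftInvertible t) : ∃ H : Matrix (Fin m) (Fin p) ℝ⟦X⟧,
      H * S.markovSeries = (PowerSeries.X : ℝ⟦X⟧) ^ t • 1 := by
  obtain ⟨H, hH, h⟩ := h
  obtain ⟨N, hN⟩ := hH.exists_expansion
  refine ⟨N, map_algebraMap_injective ?_⟩
  change (N * S.markovSeries).map _ = ((PowerSeries.X : ℝ⟦X⟧) ^ t • (1 : Matrix _ _ _)).map _
  rw [Matrix.map_mul, ← hN, ← map_expandRat_transferMatrix, ← Matrix.map_mul, h]
  ext i j
  simp only [Matrix.map_apply, Matrix.smul_apply, Matrix.one_apply, smul_eq_mul, map_mul, map_pow,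
    map_inv₀, expandRat_X, inv_inv, localParam]
  split_ifs <;> simp

theorem IsDelayLeftInvertible.eq_zero_of_mulVec {S : LTISystem n m p} {t : ℕ}
    (h : S.IsDelayLeftInvertible t) (v : Fin m → RatFunc ℝ)
    (hv : S.transferMatrix.mulVec v = 0) : v = 0 := by
  obtain ⟨H, -, h⟩ := h
  have h1 := congrArg (fun M => Matrix.mulVec M v) h
  simp only [← Matrix.mulVec_mulVec, hv, Matrix.mulVec_zero, Matrix.smul_mulVec,
    Matrix.one_mulVec] at h1
  have hX : (RatFunc.X : RatFunc ℝ)⁻¹ ^ t ≠ 0 := pow_ne_zero _ (inv_ne_zero RatFunc.X_ne_zero)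
  exact (smul_eq_zero.1 h1.symm).resolve_left hX

/-- The Smith–McMillan form at infinity of the transfer matrix as an identity of power series. -/
theorem exists_series_form {S : LTISystem n m p} {t r : ℕ} (h : S.IsDelayLeftInvertible t)
    {κ : ℕ → ℤ} (hκ : IsSmithMcMillanFormAtInfinity S.transferMatrix r κ) :
    r = m ∧ m ≤ p ∧ (∀ k < m, (κ k).toNat ≤ t) ∧
    ∃ (U : (Matrix (Fin p) (Fin p) ℝ⟦X⟧)ˣ) (V : (Matrix (Fin m) (Fin m) ℝ⟦X⟧)ˣ),
      U.1 * S.markovSeries * V.1 = rectDiag p m fun k => PowerSeries.X ^ (κ k).toNat := by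
  obtain ⟨hr, -, U, V, hU, hV, hform⟩ := hκ
  have hmr := le_of_mul_mul_eq_rectDiag h.eq_zero_of_mulVec hU.1 hV.1 hform
  obtain rfl : r = m := by omega
  have hrp : r ≤ p := by omega
  obtain ⟨U', hU'⟩ := hU.exists_expansion
  obtain ⟨V', hV'⟩ := hV.exists_expansion
  have hmap : (U'.1 * S.markovSeries * V'.1).map (algebraMap ℝ⟦X⟧ LaurentField) =
      rectDiag p r fun k => localParam ^ κ k := by
    rw [Matrix.map_mul, Matrix.map_mul, ← hU', ← hV', ← map_expandRat_transferMatrix,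
      ← Matrix.map_mul, ← Matrix.map_mul, hform]
    ext i j
    simp only [rectDiag, Matrix.map_apply, Matrix.of_apply]
    split_ifs with h1 h2
    · rw [map_zpow₀, expandRat_X, inv_zpow', neg_neg]
    · omega
    · simp
  -- A negative `κ k` would make a power of `t⁻¹` a power series; clearing the denominator and
  -- comparing constant coefficients gives `0 = 1`.
  have hnn : ∀ k < r, 0 ≤ κ k := by
    intro k hk
    by_contra hneg
    obtain ⟨e, he⟩ : ∃ e : ℕ, κ k = -((e : ℤ) + 1) := ⟨(-κ k - 1).toNat, by omega⟩
    have h1 := congrFun (congrFun hmap ⟨k, by omega⟩) ⟨k, hk⟩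
    simp only [rectDiag, Matrix.map_apply, Matrix.of_apply, if_true, he] at h1
    rw [zpow_neg, ← mul_inv_eq_one₀ (inv_ne_zero (zpow_ne_zero _ localParam_ne_zero)), inv_inv,
      ← Nat.cast_succ, zpow_natCast, localParam, ← map_pow, ← map_mul,
      ← map_one (algebraMap ℝ⟦X⟧ LaurentField)] at h1
    have h2 := congrArg PowerSeries.constantCoeff
      (IsFractionRing.injective ℝ⟦X⟧ LaurentField h1)
    simp at h2
  have hser : U'.1 * S.markovSeries * V'.1 =
      rectDiag p r fun k => PowerSeries.X ^ (κ k).toNat := by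
    apply map_algebraMap_injective
    change (U'.1 * S.markovSeries * V'.1).map _ = _
    rw [hmap]
    ext i j
    simp only [rectDiag, Matrix.map_apply, Matrix.of_apply]
    split_ifs with h1
    · rw [map_pow, ← localParam, ← zpow_natCast, Int.toNat_of_nonneg (hnn _ (by omega))]
    · simp
  refine ⟨rfl, hrp, fun k hk => ?_, U', V', hser⟩
  obtain ⟨H, hH⟩ := h.exists_series
  -- Transporting the delayed inverse to the diagonal form; its diagonal entries show that `X ^ κ_k`
  -- divides `X ^ t`.
  have h1 : (V'⁻¹).1 * H * (U'⁻¹).1 * (U'.1 * S.markovSeries * V'.1) =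
      (PowerSeries.X : ℝ⟦X⟧) ^ t • 1 := by
    have : (V'⁻¹).1 * H * (U'⁻¹).1 * (U'.1 * S.markovSeries * V'.1) =
        (V'⁻¹).1 * (H * (((U'⁻¹).1 * U'.1) * S.markovSeries)) * V'.1 := by
      simp only [Matrix.mul_assoc]
    rw [this, Units.inv_mul, Matrix.one_mul, hH, Matrix.mul_smul, Matrix.mul_one, Matrix.smul_mul,
      Units.inv_mul]
  have h2 := congrFun (congrFun h1 ⟨k, hk⟩) ⟨k, hk⟩
  rw [hser, Matrix.mul_apply, Finset.sum_eq_single ⟨k, by omega⟩] at h2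
  · simp only [rectDiag, Matrix.of_apply, if_true, Matrix.smul_apply, Matrix.one_apply_eq,
      smul_eq_mul, mul_one] at h2
    have h3 : (PowerSeries.X : ℝ⟦X⟧) ^ (κ k).toNat ∣ PowerSeries.X ^ t := Dvd.intro_left _ h2
    exact (pow_dvd_pow_iff PowerSeries.X_ne_zero PowerSeries.X_prime.not_isUnit).1 h3
  · intro i _ hi
    have : (i : ℕ) ≠ k := fun e => hi (Fin.ext e)
    simp [rectDiag, this]
  · simp

end LTISystem

/-! ### Power series modulo `X ^ L` -/

section Truncation

open scoped PowerSeries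

/-- A truncated power series, extended by zero. -/
noncomputable def truncExt (L : ℕ) : (Fin L → ℝ) →ₗ[ℝ] ℝ⟦X⟧ where
  toFun v := PowerSeries.mk fun k => if h : k < L then v ⟨k, h⟩ else 0
  map_add' v w := by
    ext k
    by_cases h : k < L <;> simp [h]
  map_smul' c v := by
    ext k
    by_cases h : k < L <;> simp [h]

theorem coeff_truncExt {L : ℕ} (v : Fin L → ℝ) (k : ℕ) :
    PowerSeries.coeff k (truncExt L v) = if h : k < L then v ⟨k, h⟩ else 0 := by
  simp [truncExt]

/-- Power series act on truncated power series. -/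
noncomputable def truncAct (L : ℕ) : ℝ⟦X⟧ →+* Module.End ℝ (Fin L → ℝ) where
  toFun a :=
    { toFun := fun v k => PowerSeries.coeff k (a * truncExt L v)
      map_add' := fun v w => by ext k; simp [mul_add]
      map_smul' := fun c v => by ext k; simp }
  map_one' := by
    refine LinearMap.ext fun v => funext fun k => ?_
    simp [coeff_truncExt]
  map_mul' a b := by
    refine LinearMap.ext fun v => funext fun k => ?_
    change PowerSeries.coeff k (a * b * truncExt L v) = PowerSeries.coeff k
      (a * truncExt L fun k => PowerSeries.coeff k (b * truncExt L v))
    rw [mul_assoc, PowerSeries.coeff_mul, PowerSeries.coeff_mul]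
    -- Only coefficients of `b * v` of index at most `k < L` enter, so truncating that product first
    -- changes nothing.
    refine Finset.sum_congr rfl fun ij hij => ?_
    have := Finset.HasAntidiagonal.mem_antidiagonal.1 hij
    rw [coeff_truncExt _ ij.2, dif_pos (by omega)]
  map_zero' := by
    refine LinearMap.ext fun v => funext fun k => ?_
    simp
  map_add' a b := by
    refine LinearMap.ext fun v => funext fun k => ?_
    simp [add_mul]

theorem truncAct_apply {L : ℕ} (a : ℝ⟦X⟧) (v : Fin L → ℝ) (k : Fin L) :
    truncAct L a v k = PowerSeries.coeff k (a * truncExt L v) := rfl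

/-- `X ^ e` delays by `e` steps, so it kills exactly the vectors supported on the last `e`
positions. -/
theorem finrank_ker_truncAct_X_pow {L e : ℕ} (he : e ≤ L) :
    Module.finrank ℝ (LinearMap.ker (truncAct L (PowerSeries.X ^ e))) = e := by
  have hmem (v : Fin L → ℝ) : v ∈ LinearMap.ker (truncAct L (PowerSeries.X ^ e)) ↔
      ∀ j : Fin L, (j : ℕ) < L - e → v j = 0 := by
    rw [LinearMap.mem_ker, funext_iff]
    simp only [truncAct_apply, PowerSeries.coeff_X_pow_mul', coeff_truncExt, Pi.zero_apply]
    constructor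
    · intro h j hj
      have := h ⟨j + e, by omega⟩
      simpa using this
    · intro h k
      split_ifs with h1 h2
      · exact h _ (by simp only; omega)
      · rfl
      · rfl
  let E : LinearMap.ker (truncAct L (PowerSeries.X ^ e)) ≃ₗ[ℝ] (Fin e → ℝ) :=
    { toFun := fun v i => v.1 ⟨L - e + i, by omega⟩
      map_add' := fun _ _ => rfl
      map_smul' := fun _ _ => rfl
      invFun := fun u => ⟨fun j => if h : L - e ≤ j then u ⟨j - (L - e), by omega⟩ else 0, by
        rw [hmem]
        intro j hj
        rw [dif_neg (by omega)]⟩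
      left_inv := fun v => by
        ext j
        simp only
        split_ifs with h
        · exact congrArg v.1 (Fin.ext (Nat.add_sub_cancel' h))
        · exact ((hmem _).1 v.2 j (by omega)).symm
      right_inv := fun u => by
        ext i
        simp }
  rw [E.finrank_eq, Module.finrank_fin_fun]

end Truncation

/-! ### Zero-output states and the splitting of the nullity -/

namespace LTISystem

open scoped PowerSeries

variable {n m p : ℕ} (S : LTISystem n m p)

/-- The output at time `k` from the initial state `x` under the input `f`. -/
def output (x : Fin n → ℝ) (f : ℕ → Fin m → ℝ) (k : ℕ) : Fin p → ℝ :=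
  (S.C * S.A ^ k).mulVec x + ∑ l ∈ Finset.range (k + 1), (S.markov (k - l)).mulVec (f l)

theorem output_zero (x : Fin n → ℝ) (f : ℕ → Fin m → ℝ) :
    S.output x f 0 = S.C.mulVec x + S.D.mulVec (f 0) := by
  simp [output, markov]

theorem output_succ (x : Fin n → ℝ) (f : ℕ → Fin m → ℝ) (k : ℕ) :
    S.output x f (k + 1) =
      S.output (S.A.mulVec x + S.B.mulVec (f 0)) (fun l => f (l + 1)) k := by
  simp only [output, Finset.sum_range_succ' _ (k + 1), Nat.add_sub_add_right, Nat.sub_zero, markov,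
    Matrix.mulVec_add, Matrix.mulVec_mulVec, pow_succ, Matrix.mul_assoc]
  abel

theorem output_add (x y : Fin n → ℝ) (f g : ℕ → Fin m → ℝ) (k : ℕ) :
    S.output (x + y) (f + g) k = S.output x f k + S.output y g k := by
  simp only [output, Matrix.mulVec_add, Pi.add_apply, Finset.sum_add_distrib]
  abel

theorem output_smul (c : ℝ) (x : Fin n → ℝ) (f : ℕ → Fin m → ℝ) (k : ℕ) :
    S.output (c • x) (c • f) k = c • S.output x f k := by
  simp only [output, Matrix.mulVec_smul, Pi.smul_apply, Finset.smul_sum, smul_add]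

theorem coeff_markovSeries_mulVec (F : Fin m → ℝ⟦X⟧) (i : Fin p) (k : ℕ) :
    PowerSeries.coeff k (S.markovSeries.mulVec F i) =
      S.output 0 (fun l j => PowerSeries.coeff l (F j)) k i := by
  simp only [output, Matrix.mulVec_zero, zero_add, Finset.sum_apply, Matrix.mulVec, dotProduct,
    map_sum, mul_comm (S.markovSeries _ _), PowerSeries.coeff_mul,
    Finset.Nat.sum_antidiagonal_eq_sum_range_succ_mk]
  rw [Finset.sum_comm]
  simp [markovSeries, mul_comm]

variable {S} in
-- Applying the expanded delayed inverse to the zero output gives `X ^ t` times the input series,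
-- and power series have no zero divisors.
theorem IsDelayLeftInvertible.input_eq_zero {t : ℕ} (h : S.IsDelayLeftInvertible t)
    {f : ℕ → Fin m → ℝ} (hf : ∀ k, S.output 0 f k = 0) : f = 0 := by
  obtain ⟨H, hH⟩ := h.exists_series
  have h0 : S.markovSeries.mulVec (fun j => PowerSeries.mk fun l => f l j) = 0 := by
    ext i k
    rw [coeff_markovSeries_mulVec]
    simp [hf]
  have h1 := congrArg (fun M => M.mulVec (fun j => PowerSeries.mk fun l => f l j)) hH
  simp only [← Matrix.mulVec_mulVec, h0, Matrix.mulVec_zero, Matrix.smul_mulVec,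
    Matrix.one_mulVec] at h1
  ext l j
  have h2 := congrFun h1.symm j
  simp only [Pi.smul_apply, smul_eq_mul, Pi.zero_apply, mul_eq_zero] at h2
  have h3 := h2.resolve_left (pow_ne_zero _ PowerSeries.X_ne_zero)
  simpa using congrArg (PowerSeries.coeff l) h3

/-- The initial states from which the output can be kept at zero for `L` steps. -/
def zeroOutputStates (L : ℕ) : Submodule ℝ (Fin n → ℝ) where
  carrier := {x | ∃ f : ℕ → Fin m → ℝ, ∀ k < L, S.output x f k = 0}
  add_mem' := by
    rintro x y ⟨f, hf⟩ ⟨g, hg⟩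
    exact ⟨f + g, fun k hk => by rw [output_add, hf k hk, hg k hk, add_zero]⟩
  zero_mem' := ⟨0, fun k _ => by simp [output]⟩
  smul_mem' := by
    rintro c x ⟨f, hf⟩
    exact ⟨c • f, fun k hk => by rw [output_smul, hf k hk, smul_zero]⟩

theorem mem_zeroOutputStates {L : ℕ} {x : Fin n → ℝ} :
    x ∈ S.zeroOutputStates L ↔ ∃ f : ℕ → Fin m → ℝ, ∀ k < L, S.output x f k = 0 := Iff.rfl

theorem mem_zeroOutputStates_succ {L : ℕ} {x : Fin n → ℝ} :
    x ∈ S.zeroOutputStates (L + 1) ↔ ∃ u : Fin m → ℝ, S.C.mulVec x + S.D.mulVec u = 0 ∧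
      S.A.mulVec x + S.B.mulVec u ∈ S.zeroOutputStates L := by
  constructor
  · rintro ⟨f, hf⟩
    refine ⟨f 0, ?_, fun l => f (l + 1), fun k hk => ?_⟩
    · rw [← output_zero]
      exact hf 0 (by omega)
    · rw [← output_succ]
      exact hf _ (by omega)
  · rintro ⟨u, hu, f, hf⟩
    -- The input `f` delayed by one step, with `u` put in front.
    refine ⟨fun l => Nat.casesOn l u f, fun k hk => ?_⟩
    cases k with
    | zero => rw [output_zero]; exact hu
    | succ k => rw [output_succ]; exact hf k (by omega)

theorem zeroOutputStates_succ_le (L : ℕ) :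
    S.zeroOutputStates (L + 1) ≤ S.zeroOutputStates L :=
  fun _ ⟨f, hf⟩ => ⟨f, fun k hk => hf k (by omega)⟩

/-- Each space is determined by the preceding one through `mem_zeroOutputStates_succ`, so one
repetition makes the chain stationary. -/
theorem zeroOutputStates_succ_eq_of_le {j L : ℕ} (hjL : j ≤ L)
    (h : S.zeroOutputStates (j + 1) = S.zeroOutputStates j) :
    S.zeroOutputStates (L + 1) = S.zeroOutputStates L := by
  induction L, hjL using Nat.le_induction with
  | base => exact h
  | succ L _ ih =>
    ext x
    rw [mem_zeroOutputStates_succ, ih, ← mem_zeroOutputStates_succ, ih]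

/-- Until the chain stabilizes, each step costs at least one of the `n` dimensions; at `k = n` only
the first alternative is possible. -/
theorem zeroOutputStates_succ_eq_or (k : ℕ) :
    S.zeroOutputStates (k + 1) = S.zeroOutputStates k ∨
      Module.finrank ℝ (S.zeroOutputStates (k + 1)) + (k + 1) ≤ n := by
  have hlt (j : ℕ) (h : S.zeroOutputStates (j + 1) ≠ S.zeroOutputStates j) :=
    Submodule.finrank_lt_finrank_of_lt ((S.zeroOutputStates_succ_le j).lt_of_ne h)
  induction k with
  | zero =>
    refine or_iff_not_imp_left.2 fun h => ?_
    have h1 := hlt 0 h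
    have h2 := Submodule.finrank_le (S.zeroOutputStates 0)
    rw [Module.finrank_fin_fun] at h2
    omega
  | succ k ih =>
    rcases ih with h | h
    · exact Or.inl (S.zeroOutputStates_succ_eq_of_le (Nat.le_succ k) h)
    · refine or_iff_not_imp_left.2 fun h' => ?_
      have h1 := hlt (k + 1) h'
      omega

theorem zeroOutputStates_stable {L : ℕ} (hL : n ≤ L) :
    S.zeroOutputStates L = S.zeroOutputStates n := by
  induction L, hL using Nat.le_induction with
  | base => rfl
  | succ L hL ih =>
    rw [← ih]
    exact S.zeroOutputStates_succ_eq_of_le hL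
      ((S.zeroOutputStates_succ_eq_or n).resolve_right (by omega))

/-- Stationarity makes the limit space controlled invariant: a chosen input keeps the state inside
with zero output, and this can be iterated forever. -/
theorem exists_trajectory {x₀ : Fin n → ℝ} (hx : x₀ ∈ S.zeroOutputStates n) :
    ∃ (x : ℕ → Fin n → ℝ) (f : ℕ → Fin m → ℝ), x 0 = x₀ ∧
      ∀ k, x (k + 1) = S.A.mulVec (x k) + S.B.mulVec (f k) ∧
        S.C.mulVec (x k) + S.D.mulVec (f k) = 0 := by
  have h (x : S.zeroOutputStates n) : ∃ u : Fin m → ℝ, S.C.mulVec x + S.D.mulVec u = 0 ∧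
      S.A.mulVec x + S.B.mulVec u ∈ S.zeroOutputStates n := by
    rw [← mem_zeroOutputStates_succ, S.zeroOutputStates_stable (Nat.le_succ n)]
    exact x.2
  choose u hu hmem using h
  let x : ℕ → S.zeroOutputStates n := fun k => Nat.rec ⟨x₀, hx⟩ (fun _ x => ⟨_, hmem x⟩) k
  exact ⟨fun k => (x k).1, fun k => u (x k), rfl, fun k => ⟨rfl, hu (x k)⟩⟩

theorem output_trajectory {x : ℕ → Fin n → ℝ} {f : ℕ → Fin m → ℝ}
    (h : ∀ k, x (k + 1) = S.A.mulVec (x k) + S.B.mulVec (f k)) (k : ℕ) :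
    S.output (x 0) f k = S.C.mulVec (x k) + S.D.mulVec (f k) := by
  induction k generalizing x f with
  | zero => exact S.output_zero _ _
  | succ k ih =>
    rw [output_succ, ← h 0]
    exact ih (x := fun k => x (k + 1)) (f := fun k => f (k + 1)) fun k => h (k + 1)

/-- The input sequence with the values `g` up to time `L`, and zero afterwards. -/
def extendInput {L : ℕ} (g : Fin L × Fin m → ℝ) (l : ℕ) (j : Fin m) : ℝ :=
  if h : l < L then g (⟨l, h⟩, j) else 0

theorem fromCols_mulVec_apply {L : ℕ} (v : Fin n ⊕ Fin L × Fin m → ℝ) (k : Fin L) (i : Fin p) :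
    (Matrix.fromCols (S.obsMatrix L) (S.toeplitzMatrix L)).mulVec v (k, i) =
      S.output (v ∘ Sum.inl) (extendInput (v ∘ Sum.inr)) k i := by
  rw [Matrix.fromCols_mulVec, Pi.add_apply, output, Pi.add_apply, Finset.sum_apply]
  congr 1
  simp only [Matrix.mulVec, dotProduct, toeplitzMatrix, Matrix.of_apply, Fintype.sum_prod_type,
    ite_mul, zero_mul]
  have hsub : Finset.range (k + 1) ⊆ Finset.range L :=
    Finset.range_subset_range.2 k.2
  rw [Finset.sum_subset_zero_on_sdiff hsub (g := fun l => if l ≤ (k : ℕ) then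
      ∑ j, S.markov (k - l) i j * extendInput (v ∘ Sum.inr) l j else 0), Finset.sum_range]
  · refine Finset.sum_congr rfl fun l _ => ?_
    by_cases hlk : l ≤ k
    · have hlk' : (l : ℕ) ≤ k := hlk
      simp [extendInput, hlk, hlk']
    · have hlk' : ¬ (l : ℕ) ≤ k := hlk
      simp [hlk, hlk']
  · intro l hl
    rw [if_neg]
    simp at hl
    omega
  · intro l hl
    rw [if_pos]
    simp at hl
    omega

theorem mem_ker_fromCols {L : ℕ} (v : Fin n ⊕ Fin L × Fin m → ℝ) :
    v ∈ LinearMap.ker (Matrix.fromCols (S.obsMatrix L) (S.toeplitzMatrix L)).mulVecLin ↔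
      ∀ k < L, S.output (v ∘ Sum.inl) (extendInput (v ∘ Sum.inr)) k = 0 := by
  rw [LinearMap.mem_ker, Matrix.mulVecLin_apply, funext_iff]
  simp only [Prod.forall, fromCols_mulVec_apply, Pi.zero_apply]
  exact ⟨fun h k hk => funext fun i => h ⟨k, hk⟩ i, fun h k i => congrFun (h k k.2) i⟩

theorem output_congr {L k : ℕ} (hk : k < L) (x : Fin n → ℝ) {f g : ℕ → Fin m → ℝ}
    (h : ∀ l < L, f l = g l) : S.output x f k = S.output x g k := by
  unfold output
  congr 1
  refine Finset.sum_congr rfl fun l hl => ?_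
  rw [h l]
  have := Finset.mem_range.1 hl
  omega

/-- The initial state of an element of the null space of `[O_L  T_L]`. -/
def initialState (L : ℕ) :
    LinearMap.ker (Matrix.fromCols (S.obsMatrix L) (S.toeplitzMatrix L)).mulVecLin →ₗ[ℝ]
      (Fin n → ℝ) :=
  (LinearMap.funLeft ℝ ℝ Sum.inl).comp (Submodule.subtype _)

theorem range_initialState (L : ℕ) :
    LinearMap.range (S.initialState L) = S.zeroOutputStates L := by
  ext x
  rw [mem_zeroOutputStates]
  constructor
  · rintro ⟨v, rfl⟩
    exact ⟨_, (S.mem_ker_fromCols _).1 v.2⟩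
  · rintro ⟨f, hf⟩
    refine ⟨⟨Sum.elim x fun lj => f lj.1 lj.2, (S.mem_ker_fromCols _).2 fun k hk => ?_⟩, rfl⟩
    rw [← hf k hk]
    refine S.output_congr hk _ fun l hl => ?_
    ext j
    simp [extendInput, hl]

/-- From the zero state, the Toeplitz matrix is multiplication by the Markov series modulo `X ^ L`.
-/
theorem finrank_ker_initialState (L : ℕ) :
    Module.finrank ℝ (LinearMap.ker (S.initialState L)) =
      Module.finrank ℝ (LinearMap.ker (matAct (truncAct L) S.markovSeries)) := by
  have hmat (w : Fin m → Fin L → ℝ) (i : Fin p) (k : Fin L) :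
      matAct (truncAct L) S.markovSeries w i k =
        S.output 0 (extendInput fun lj => w lj.2 lj.1) k i := by
    have h := S.coeff_markovSeries_mulVec (fun j => truncExt L (w j)) i k
    simp only [coeff_truncExt] at h
    unfold extendInput
    rw [← h, matAct_apply, Finset.sum_apply, Matrix.mulVec, dotProduct, map_sum]
    rfl
  have hker (w : Fin m → Fin L → ℝ) :
      w ∈ LinearMap.ker (matAct (truncAct L) S.markovSeries) ↔
        ∀ k < L, S.output 0 (extendInput fun lj => w lj.2 lj.1) k = 0 := by
    rw [LinearMap.mem_ker]
    constructor
    · intro h k hk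
      ext i
      rw [← hmat w i ⟨k, hk⟩, h]
      rfl
    · intro h
      ext i k
      rw [hmat, h k k.2]
      rfl
  let E : LinearMap.ker (S.initialState L) ≃ₗ[ℝ]
      LinearMap.ker (matAct (truncAct L) S.markovSeries) :=
    { toFun := fun v => ⟨fun j l => v.1.1 (Sum.inr (l, j)), by
        rw [hker]
        have h := (S.mem_ker_fromCols _).1 v.1.2
        have h0 : v.1.1 ∘ Sum.inl = 0 := v.2
        rw [h0] at h
        exact h⟩
      map_add' := fun _ _ => rfl
      map_smul' := fun _ _ => rfl
      invFun := fun w => ⟨⟨Sum.elim 0 fun lj => w.1 lj.2 lj.1,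
        (S.mem_ker_fromCols _).2 ((hker _).1 w.2)⟩, rfl⟩
      left_inv := fun v => by
        have h0 : v.1.1 ∘ Sum.inl = 0 := v.2
        ext s
        cases s with
        | inl i => exact (congrFun h0 i).symm
        | inr lj => rfl
      right_inv := fun _ => rfl }
  exact E.finrank_eq

theorem obsToeplitzNullity_eq_add {L : ℕ} (hL : n ≤ L) :
    S.obsToeplitzNullity L = Module.finrank ℝ (S.zeroOutputStates n) +
      Module.finrank ℝ (LinearMap.ker (matAct (truncAct L) S.markovSeries)) := by
  rw [obsToeplitzNullity, ← LinearMap.finrank_range_add_finrank_ker (S.initialState L),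
    finrank_ker_initialState, range_initialState, S.zeroOutputStates_stable hL]

variable {S} in
/-- The number of infinite zeros is the nullity of a large Toeplitz matrix. -/
theorem IsDelayLeftInvertible.eq_finrank_ker_of_infinite {t L ζ : ℕ}
    (h : S.IsDelayLeftInvertible t) (hL : t ≤ L) (hζ : IsNumInfiniteZeros S.transferMatrix ζ) :
    ζ = Module.finrank ℝ (LinearMap.ker (matAct (truncAct L) S.markovSeries)) := by
  obtain ⟨r, κ, hκ, rfl⟩ := hζ
  obtain ⟨rfl, hmp, hle, U, V, hform⟩ := exists_series_form h hκ
  rw [← finrank_ker_matAct_of_unit_mul_mul_unit (truncAct L) U S.markovSeries V, hform,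
    finrank_ker_matAct_rectDiag _ hmp _ fun _ _ => inferInstance]
  refine Finset.sum_congr rfl fun k hk => ?_
  rw [finrank_ker_truncAct_X_pow ((hle k (Finset.mem_range.1 hk)).trans hL)]

end LTISystem

/-! ### Bezout identities from observability and controllability -/

section Bezout

open Polynomial

theorem exists_right_inverse_of_rank_eq {n : ℕ} {κ : Type*} [Fintype κ]
    (M : Matrix (Fin n) κ ℝ) (h : M.rank = n) : ∃ F : Matrix κ (Fin n) ℝ, M * F = 1 := by
  classical
  rw [← Matrix.mulVec_surjective_iff_exists_right_inverse]
  have : LinearMap.range M.mulVecLin = ⊤ := by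
    apply Submodule.eq_top_of_finrank_eq
    rw [Module.finrank_fin_fun]
    exact h
  exact LinearMap.range_eq_top.1 this

/-- A Bezout identity for `z I - A` and `C`, when `A`, `C` is observable. -/
theorem exists_bezout_of_sum_eq_one {n p : ℕ} (A : Matrix (Fin n) (Fin n) ℝ)
    (C : Matrix (Fin p) (Fin n) ℝ) (E : Fin n → Matrix (Fin n) (Fin p) ℝ)
    (h : ∑ k : Fin n, E k * (C * A ^ (k : ℕ)) = 1) :
    ∃ (R : Matrix (Fin n) (Fin n) ℝ[X]) (S : Matrix (Fin n) (Fin p) ℝ[X]),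
      R * A.charmatrix + S * C.map Polynomial.C = 1 := by
  set A' : Matrix (Fin n) (Fin n) ℝ[X] := A.map Polynomial.C with hA'
  set Z : Matrix (Fin n) (Fin n) ℝ[X] := Matrix.scalar (Fin n) X with hZ
  have hcomm : Commute Z A' := Matrix.scalar_commute _ (fun r => Commute.all _ _) _
  have hchar : A.charmatrix = Z - A' := rfl
  have h1 : ∑ k : Fin n, (E k).map Polynomial.C * (C.map Polynomial.C * A' ^ (k : ℕ)) = 1 := by
    have := congrArg (fun M => M.map (Polynomial.C : ℝ →+* ℝ[X])) h
    rw [Matrix.map_one _ (map_zero _) (map_one _)] at this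
    rw [← this]
    change _ = (Polynomial.C : ℝ →+* ℝ[X]).mapMatrix _
    rw [map_sum]
    refine Finset.sum_congr rfl fun k _ => ?_
    rw [RingHom.mapMatrix_apply, Matrix.map_mul, Matrix.map_mul]
    congr 2
    exact ((Polynomial.C : ℝ →+* ℝ[X]).mapMatrix.map_pow A k).symm
  -- Modulo left multiples of `Z - A'`, `A' ^ k` may be replaced by the scalar `Z ^ k`; this turns
  -- each `C A ^ k` into `z ^ k C`.
  have h2 (k : ℕ) : A' ^ k = Z ^ k -
      (∑ i ∈ Finset.range k, Z ^ i * A' ^ (k - 1 - i)) * (Z - A') := by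
    rw [hcomm.geom_sum₂_mul, sub_sub_cancel]
  have h3 (k : ℕ) : C.map Polynomial.C * Z ^ k = (X : ℝ[X]) ^ k • C.map Polynomial.C := by
    rw [hZ, ← map_pow]
    ext1 i j
    rw [Matrix.scalar_apply, Matrix.mul_diagonal, Matrix.smul_apply, smul_eq_mul, mul_comm]
  refine ⟨-∑ k : Fin n, (E k).map Polynomial.C * (C.map Polynomial.C *
    ∑ i ∈ Finset.range k, Z ^ i * A' ^ ((k : ℕ) - 1 - i)),
    ∑ k : Fin n, (X : ℝ[X]) ^ (k : ℕ) • (E k).map Polynomial.C, ?_⟩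
  rw [hchar, ← h1, neg_mul, Finset.sum_mul, Matrix.sum_mul, ← Finset.sum_neg_distrib,
    ← Finset.sum_add_distrib]
  refine Finset.sum_congr rfl fun k _ => ?_
  conv_rhs => rw [h2, Matrix.mul_sub, h3]
  simp only [Matrix.mul_sub, Matrix.mul_smul, Matrix.smul_mul, Matrix.mul_assoc]
  abel

end Bezout

/-! ### Zero-output trajectories and the system matrix -/

namespace LTISystem

open Polynomial hiding C

variable {n m p : ℕ} (S : LTISystem n m p)

variable {S} in
theorem IsObservable.exists_bezout (h : S.IsObservable) :
    ∃ (R : Matrix (Fin n) (Fin n) ℝ[X]) (T : Matrix (Fin n) (Fin p) ℝ[X]),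
      R * S.A.charmatrix + T * S.C.map Polynomial.C = 1 := by
  obtain ⟨F, hF⟩ := exists_right_inverse_of_rank_eq (S.obsMatrix n).transpose
    ((Matrix.rank_transpose _).trans h)
  refine exists_bezout_of_sum_eq_one S.A S.C (fun k => Matrix.of fun i j => F (k, j) i) ?_
  have h1 := congrArg Matrix.transpose hF
  rw [Matrix.transpose_mul, Matrix.transpose_transpose, Matrix.transpose_one] at h1
  rw [← h1]
  ext i j
  simp only [Matrix.sum_apply, Matrix.mul_apply (N := S.obsMatrix n), Fintype.sum_prod_type]
  refine Finset.sum_congr rfl fun k _ => ?_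
  rw [Matrix.mul_apply]
  rfl

variable {S} in
theorem IsControllable.exists_bezout (h : S.IsControllable) :
    ∃ (R : Matrix (Fin n) (Fin n) ℝ[X]) (T : Matrix (Fin m) (Fin n) ℝ[X]),
      S.A.charmatrix * R + S.B.map Polynomial.C * T = 1 := by
  obtain ⟨F, hF⟩ := exists_right_inverse_of_rank_eq S.ctrbMatrix h
  obtain ⟨R, T, hRT⟩ := exists_bezout_of_sum_eq_one S.A.transpose S.B.transpose
    (fun k => Matrix.of fun i j => F (k, j) i) (by
      rw [← Matrix.transpose_one, ← hF, Matrix.transpose_mul]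
      ext i j
      simp only [Matrix.sum_apply, Matrix.mul_apply (N := S.ctrbMatrix.transpose),
        Fintype.sum_prod_type]
      refine Finset.sum_congr rfl fun k _ => ?_
      rw [← Matrix.transpose_pow, ← Matrix.transpose_mul, Matrix.mul_apply]
      rfl)
  refine ⟨R.transpose, T.transpose, ?_⟩
  have h1 := congrArg Matrix.transpose hRT
  rw [Matrix.transpose_add, Matrix.transpose_mul, Matrix.transpose_mul,
    Matrix.charmatrix_transpose, Matrix.transpose_transpose, Matrix.transpose_one,
    Matrix.transpose_map, Matrix.transpose_transpose] at h1
  exact h1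

/-- The trajectories of the system with zero output, as pairs of a state and an input sequence. -/
noncomputable def zeroOutputTrajectories : Submodule ℝ ((Fin n → ℕ → ℝ) × (Fin m → ℕ → ℝ)) where
  carrier := {xf | matAct seqAct S.A.charmatrix xf.1 = matAct seqAct (S.B.map Polynomial.C) xf.2 ∧
    matAct seqAct (S.C.map Polynomial.C) xf.1 + matAct seqAct (S.D.map Polynomial.C) xf.2 = 0}
  add_mem' := by
    rintro a b ⟨ha, ha'⟩ ⟨hb, hb'⟩
    refine ⟨by simp [ha, hb], ?_⟩
    simp only [Prod.fst_add, Prod.snd_add, map_add]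
    rw [add_add_add_comm, ha', hb', add_zero]
  zero_mem' := by simp
  smul_mem' := by
    rintro c a ⟨ha, ha'⟩
    refine ⟨by simp [ha], ?_⟩
    simp only [Prod.smul_fst, Prod.smul_snd, map_smul]
    rw [← smul_add, ha', smul_zero]

theorem mem_zeroOutputTrajectories {xf : (Fin n → ℕ → ℝ) × (Fin m → ℕ → ℝ)} :
    xf ∈ S.zeroOutputTrajectories ↔
      matAct seqAct S.A.charmatrix xf.1 = matAct seqAct (S.B.map Polynomial.C) xf.2 ∧
      matAct seqAct (S.C.map Polynomial.C) xf.1 + matAct seqAct (S.D.map Polynomial.C) xf.2 = 0 := Iff.rfl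

theorem matAct_map_C_apply {a b : ℕ} (M : Matrix (Fin a) (Fin b) ℝ) (w : Fin b → ℕ → ℝ)
    (i : Fin a) (k : ℕ) :
    matAct seqAct (M.map Polynomial.C) w i k = M.mulVec (fun j => w j k) i := by
  simp [matAct_apply, Matrix.mulVec, dotProduct, seqAct_C]

theorem matAct_charmatrix_apply (A : Matrix (Fin n) (Fin n) ℝ) (w : Fin n → ℕ → ℝ)
    (i : Fin n) (k : ℕ) :
    matAct seqAct A.charmatrix w i k = w i (k + 1) - A.mulVec (fun j => w j k) i := by
  have h := matAct_add seqAct A.charmatrix (A.map Polynomial.C) w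
  have h1 : A.charmatrix + A.map Polynomial.C = Matrix.scalar (Fin n) X := by
    rw [Matrix.charmatrix, RingHom.mapMatrix_apply, sub_add_cancel]
  have h2 := congrFun (congrFun h i) k
  rw [Pi.add_apply, Pi.add_apply, matAct_map_C_apply, h1, matAct_apply,
    Finset.sum_eq_single i] at h2
  · rw [eq_sub_iff_add_eq, ← h2, Matrix.scalar_apply, Matrix.diagonal_apply_eq, seqAct_X]
  · intro j _ hj
    rw [Matrix.scalar_apply, Matrix.diagonal_apply_ne' _ hj]
    simp
  · simp

theorem mem_zeroOutputTrajectories_iff {xf : (Fin n → ℕ → ℝ) × (Fin m → ℕ → ℝ)} :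
    xf ∈ S.zeroOutputTrajectories ↔ ∀ k, (fun i => xf.1 i (k + 1)) =
        S.A.mulVec (fun i => xf.1 i k) + S.B.mulVec (fun j => xf.2 j k) ∧
      S.C.mulVec (fun i => xf.1 i k) + S.D.mulVec (fun j => xf.2 j k) = 0 := by
  simp only [mem_zeroOutputTrajectories, funext_iff, Pi.add_apply, matAct_map_C_apply,
    matAct_charmatrix_apply, sub_eq_iff_eq_add', Pi.zero_apply]
  exact ⟨fun h k => ⟨fun i => h.1 i k, fun i => h.2 i k⟩,
    fun h => ⟨fun i k => (h k).1 i, fun i k => (h k).2 i⟩⟩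

variable {S} in
-- Evaluation of the state at time `0` is the isomorphism. It is injective because zero output from
-- the zero state forces zero input, and then zero state.
theorem IsDelayLeftInvertible.finrank_zeroOutputTrajectories {t : ℕ}
    (h : S.IsDelayLeftInvertible t) :
    Module.finrank ℝ S.zeroOutputTrajectories = Module.finrank ℝ (S.zeroOutputStates n) := by
  let φ : S.zeroOutputTrajectories →ₗ[ℝ] (Fin n → ℝ) :=
    { toFun := fun xf i => xf.1.1 i 0
      map_add' := fun _ _ => rfl
      map_smul' := fun _ _ => rfl }
  have hinj : Function.Injective φ := by
    rw [← LinearMap.ker_eq_bot, LinearMap.ker_eq_bot']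
    rintro ⟨⟨x, f⟩, hxf⟩ h0
    change (fun i => x i 0) = 0 at h0
    rw [mem_zeroOutputTrajectories_iff] at hxf
    have hf := h.input_eq_zero (f := fun k j => f j k) fun k => by
      rw [← h0, S.output_trajectory (x := fun k i => x i k) (fun k => (hxf k).1) k]
      exact (hxf k).2
    have hx (k : ℕ) : (fun i => x i k) = 0 := by
      induction k with
      | zero => exact h0
      | succ k ih =>
        rw [(hxf k).1]
        simp only
        rw [ih, congrFun hf k]
        simp
    ext i k
    · exact congrFun (hx k) i
    · exact congrFun (congrFun hf k) i
  have hrange : LinearMap.range φ = S.zeroOutputStates n := by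
    ext x₀
    constructor
    · rintro ⟨⟨⟨x, f⟩, hxf⟩, rfl⟩
      rw [mem_zeroOutputTrajectories_iff] at hxf
      refine ⟨fun k j => f j k, fun k _ => ?_⟩
      exact (S.output_trajectory (x := fun k i => x i k) (fun k => (hxf k).1) k).trans (hxf k).2
    · intro hx
      obtain ⟨x, f, rfl, hxf⟩ := S.exists_trajectory hx
      exact ⟨⟨(fun i k => x k i, fun j k => f k j), S.mem_zeroOutputTrajectories_iff.2 hxf⟩, rfl⟩
  rw [← hrange, LinearMap.finrank_range_of_inj hinj]

/-- The system matrix as a polynomial matrix. -/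
noncomputable def systemPoly : Matrix (Fin (n + p)) (Fin (n + m)) ℝ[X] :=
  Matrix.reindex finSumFinEquiv finSumFinEquiv
    (Matrix.fromBlocks (-S.A.charmatrix) (S.B.map Polynomial.C) (S.C.map Polynomial.C) (S.D.map Polynomial.C))

theorem polyToRat_map_C {a b : ℕ} (M : Matrix (Fin a) (Fin b) ℝ) :
    polyToRat (M.map Polynomial.C) = M.map RatFunc.C := by
  ext i j
  simp [polyToRat]

theorem polyToRat_systemPoly : polyToRat S.systemPoly = S.systemMatrix := by
  have h : (S.systemMatrix).submatrix finSumFinEquiv finSumFinEquiv =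
      (polyToRat S.systemPoly).submatrix finSumFinEquiv finSumFinEquiv := by
    have h1 : S.A.map RatFunc.C - Matrix.scalar (Fin n) RatFunc.X =
        -polyToRat S.A.charmatrix := by
      rw [polyToRat_charmatrix, neg_sub]
    rw [systemMatrix, h1, ← polyToRat_map_C, ← polyToRat_map_C, ← polyToRat_map_C]
    ext (i | i) (j | j) <;> simp [polyToRat, systemPoly]
  ext i j
  have := congrFun (congrFun h (finSumFinEquiv.symm i)) (finSumFinEquiv.symm j)
  simpa using this.symm

variable {S} in
-- Eliminating `x = (z - A)⁻¹ B f` from the first block row leaves `G f = 0` in the second.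
theorem IsDelayLeftInvertible.eq_zero_of_systemMatrix_mulVec {t : ℕ}
    (h : S.IsDelayLeftInvertible t) (v : Fin (n + m) → RatFunc ℝ)
    (hv : S.systemMatrix.mulVec v = 0) : v = 0 := by
  rw [systemMatrix, Matrix.reindex_apply, Matrix.submatrix_mulVec_equiv, Equiv.symm_symm,
    Matrix.fromBlocks_mulVec] at hv
  set x : Fin n → RatFunc ℝ := (v ∘ finSumFinEquiv) ∘ Sum.inl with hxdef
  set f : Fin m → RatFunc ℝ := (v ∘ finSumFinEquiv) ∘ Sum.inr with hfdef
  have h1 : (S.A.map RatFunc.C - Matrix.scalar (Fin n) RatFunc.X).mulVec x +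
      (S.B.map RatFunc.C).mulVec f = 0 := by
    ext i
    simpa using congrFun hv (finSumFinEquiv (Sum.inl i))
  have h2 : (S.C.map RatFunc.C).mulVec x + (S.D.map RatFunc.C).mulVec f = 0 := by
    ext i
    simpa using congrFun hv (finSumFinEquiv (Sum.inr i))
  set Z := Matrix.scalar (Fin n) RatFunc.X - S.A.map RatFunc.C with hZ
  have hdet := (Matrix.isUnit_iff_isUnit_det _).1 (isUnit_scalar_sub S.A)
  have hx : x = (Z⁻¹ * S.B.map RatFunc.C).mulVec f := by
    rw [← neg_sub, ← hZ, Matrix.neg_mulVec, neg_add_eq_zero] at h1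
    rw [← Matrix.mulVec_mulVec, ← h1, Matrix.mulVec_mulVec, Matrix.nonsing_inv_mul _ hdet,
      Matrix.one_mulVec]
  have hf : f = 0 := by
    apply h.eq_zero_of_mulVec
    rw [transferMatrix, Matrix.add_mulVec, ← h2, hx, Matrix.mulVec_mulVec, Matrix.mul_assoc]
  rw [hf, Matrix.mulVec_zero] at hx
  have : v ∘ finSumFinEquiv = 0 := by
    ext (i | j)
    · exact congrFun hx i
    · exact congrFun hf j
  ext i
  simpa using congrFun this (finSumFinEquiv.symm i)

theorem finrank_ker_systemPoly :
    Module.finrank ℝ (LinearMap.ker (matAct seqAct S.systemPoly)) =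
      Module.finrank ℝ S.zeroOutputTrajectories := by
  let e : (Fin (n + m) → ℕ → ℝ) ≃ₗ[ℝ] (Fin n → ℕ → ℝ) × (Fin m → ℕ → ℝ) :=
    (LinearEquiv.funCongrLeft ℝ (ℕ → ℝ) finSumFinEquiv).trans
      (LinearEquiv.sumArrowLequivProdArrow (Fin n) (Fin m) ℝ (ℕ → ℝ))
  have hl (w : Fin (n + m) → ℕ → ℝ) (i : Fin n) :
      matAct seqAct S.systemPoly w (Fin.castAdd p i) =
        -matAct seqAct S.A.charmatrix (e w).1 i + matAct seqAct (S.B.map Polynomial.C) (e w).2 i := by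
    simp only [matAct_apply, Fin.sum_univ_add]
    simp [systemPoly, e, LinearEquiv.funCongrLeft, LinearMap.funLeft]
  have hr (w : Fin (n + m) → ℕ → ℝ) (i : Fin p) :
      matAct seqAct S.systemPoly w (Fin.natAdd n i) =
        matAct seqAct (S.C.map Polynomial.C) (e w).1 i + matAct seqAct (S.D.map Polynomial.C) (e w).2 i := by
    simp only [matAct_apply, Fin.sum_univ_add]
    simp [systemPoly, e, LinearEquiv.funCongrLeft, LinearMap.funLeft]
  have h : LinearMap.ker (matAct seqAct S.systemPoly) =
      S.zeroOutputTrajectories.map e.symm.toLinearMap := by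
    ext w
    rw [← Submodule.comap_equiv_eq_map_symm, Submodule.mem_comap, LinearMap.mem_ker,
      mem_zeroOutputTrajectories, funext_iff, funext_iff, funext_iff, Fin.forall_fin_add]
    simp only [hl, hr, Pi.zero_apply, neg_add_eq_zero, LinearEquiv.coe_coe, Pi.add_apply]
  rw [h]
  exact LinearEquiv.finrank_map_eq _ _

end LTISystem

/-! ### Coprime factorization and zeros of the transfer function -/

theorem matAct_sub {R k M : Type*} [CommRing R] [Field k] [AddCommGroup M] [Module k M]
    (ρ : R →+* Module.End k M) {ι κ : Type*} [Fintype κ] (P Q : Matrix ι κ R) (w : κ → M) :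
    matAct ρ (P - Q) w = matAct ρ P w - matAct ρ Q w := by
  rw [eq_sub_iff_add_eq, ← matAct_add, sub_add_cancel]

theorem rectDiag_mul_rectDiag {R : Type*} [NonUnitalNonAssocSemiring R] {a b c : ℕ} (hcb : c ≤ b)
    (d e : ℕ → R) :
    rectDiag a b d * rectDiag b c e = rectDiag a c fun k => d k * e k := by
  ext i j
  rw [Matrix.mul_apply, Finset.sum_eq_single ⟨j, by omega⟩]
  · by_cases h : (i : ℕ) = j <;> simp [rectDiag, h]
  · intro k _ hk
    have : (k : ℕ) ≠ j := fun h => hk (Fin.ext h)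
    simp [rectDiag, this]
  · simp

theorem rectDiag_eq_one {R : Type*} [Zero R] [One R] {a : ℕ} {d : ℕ → R} (h : ∀ k < a, d k = 1) :
    rectDiag a a d = 1 := by
  ext i j
  simp only [rectDiag, Matrix.of_apply, Matrix.one_apply, Fin.ext_iff]
  split_ifs
  · exact h i i.2
  · rfl

namespace LTISystem

open Polynomial hiding C

variable {n m p : ℕ} {S : LTISystem n m p}

/-- A right coprime factorization `N D⁻¹` of the transfer matrix, together with the state
`X = (z I - A)⁻¹ B D` and a Bezout identity for `X` and `D`. -/
theorem exists_coprime_factorization (hobs : S.IsObservable) {ε ψ : ℕ → ℝ[X]}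
    (hmp : m ≤ p) (hk : ∀ k < m, (ε k).Monic ∧ (ψ k).Monic ∧ IsCoprime (ε k) (ψ k))
    {U : Matrix (Fin p) (Fin p) ℝ[X]} {V : Matrix (Fin m) (Fin m) ℝ[X]}
    (hU : IsUnit U) (hV : IsUnit V)
    (hform : polyToRat U * S.transferMatrix * polyToRat V = rectDiag p m (fun k =>
      algebraMap ℝ[X] (RatFunc ℝ) (ε k) / algebraMap ℝ[X] (RatFunc ℝ) (ψ k))) :
    ∃ (N : Matrix (Fin p) (Fin m) ℝ[X]) (D : Matrix (Fin m) (Fin m) ℝ[X])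
      (X : Matrix (Fin n) (Fin m) ℝ[X]) (Q : Matrix (Fin m) (Fin n) ℝ[X])
      (Y : Matrix (Fin m) (Fin m) ℝ[X]),
      U * N = rectDiag p m ε ∧ IsUnit (polyToRat D) ∧
      S.A.charmatrix * X = S.B.map Polynomial.C * D ∧
      N = S.C.map Polynomial.C * X + S.D.map Polynomial.C * D ∧ Q * X + Y * D = 1 := by
  obtain ⟨U, rfl⟩ := hU
  obtain ⟨V, rfl⟩ := hV
  obtain ⟨R, T, hRT⟩ := hobs.exists_bezout
  have hψ0 (k : ℕ) (h : k < m) : algebraMap ℝ[X] (RatFunc ℝ) (ψ k) ≠ 0 := by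
    simpa using (hk k h).2.1.ne_zero
  set N : Matrix (Fin p) (Fin m) ℝ[X] := (U⁻¹).1 * rectDiag p m ε with hN
  set D : Matrix (Fin m) (Fin m) ℝ[X] := V.1 * rectDiag m m ψ with hD
  clear_value N D
  have hUN : U.1 * N = rectDiag p m ε := by
    rw [hN, ← Matrix.mul_assoc, Units.mul_inv, Matrix.one_mul]
  have hDu : IsUnit (polyToRat D) := by
    rw [hD, polyToRat_mul]
    refine (isUnit_polyToRat V.isUnit).mul ?_
    rw [polyToRat_rectDiag]
    refine IsUnit.of_mul_eq_one (rectDiag m m fun k => (algebraMap ℝ[X] (RatFunc ℝ) (ψ k))⁻¹) ?_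
    rw [rectDiag_mul_rectDiag le_rfl]
    exact rectDiag_eq_one fun k h => mul_inv_cancel₀ (hψ0 k h)
  have hGD : S.transferMatrix * polyToRat D = polyToRat N := by
    have h1 : polyToRat U.1 * (S.transferMatrix * polyToRat D) = polyToRat (rectDiag p m ε) := by
      rw [hD, polyToRat_mul, ← Matrix.mul_assoc, ← Matrix.mul_assoc, hform, polyToRat_rectDiag,
        polyToRat_rectDiag, rectDiag_mul_rectDiag le_rfl]
      exact rectDiag_congr fun k h => div_mul_cancel₀ _ (hψ0 k h)
    rw [hN, polyToRat_mul, ← h1, ← Matrix.mul_assoc (polyToRat _), ← polyToRat_mul,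
      Units.inv_mul, polyToRat_one, Matrix.one_mul]
  -- The state `ξ = (z - A)⁻¹ B D` is a priori only rational. Applying `R (z - A) + T C = 1` to it,
  -- with `(z - A) ξ = B D` and `C ξ = N - D_f D`, gives this polynomial expression.
  set X : Matrix (Fin n) (Fin m) ℝ[X] :=
    R * (S.B.map Polynomial.C * D) + T * (N - S.D.map Polynomial.C * D) with hX
  set Z := Matrix.scalar (Fin n) RatFunc.X - S.A.map RatFunc.C with hZ
  have hZp : polyToRat S.A.charmatrix = Z := polyToRat_charmatrix _
  have hdet := (Matrix.isUnit_iff_isUnit_det _).1 (isUnit_scalar_sub S.A)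
  set ξ := Z⁻¹ * (S.B.map RatFunc.C * polyToRat D) with hξ
  clear_value ξ
  have hZξ : Z * ξ = S.B.map RatFunc.C * polyToRat D := by
    rw [hξ, ← Matrix.mul_assoc, Matrix.mul_nonsing_inv _ hdet, Matrix.one_mul]
  have hCξ : polyToRat N = S.C.map RatFunc.C * ξ + S.D.map RatFunc.C * polyToRat D := by
    rw [← hGD, transferMatrix, Matrix.add_mul, hξ]
    simp only [Matrix.mul_assoc, hZ]
  have hXξ : polyToRat X = ξ := by
    have h1 := congrArg polyToRat hRT
    rw [polyToRat_add, polyToRat_mul, polyToRat_mul, hZp, polyToRat_map_C, polyToRat_one] at h1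
    rw [hX, polyToRat_add, polyToRat_mul, polyToRat_mul, polyToRat_mul, polyToRat_sub,
      polyToRat_mul, polyToRat_map_C, polyToRat_map_C, ← hZξ, hCξ, add_sub_cancel_right,
      ← Matrix.mul_assoc, ← Matrix.mul_assoc, ← Matrix.add_mul, h1, Matrix.one_mul]
  have hZX : S.A.charmatrix * X = S.B.map Polynomial.C * D := by
    apply polyToRat_injective
    rw [polyToRat_mul, polyToRat_mul, hZp, polyToRat_map_C, hXξ, hZξ]
  have hNX : N = S.C.map Polynomial.C * X + S.D.map Polynomial.C * D := by
    apply polyToRat_injective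
    rw [polyToRat_add, polyToRat_mul, polyToRat_mul, polyToRat_map_C, polyToRat_map_C, hXξ, hCξ]
  have hbez : ∃ (a b : ℕ → ℝ[X]), ∀ k < m, a k * ε k + b k * ψ k = 1 := by
    have h1 (k : ℕ) : ∃ a b : ℝ[X], k < m → a * ε k + b * ψ k = 1 := by
      by_cases h : k < m
      · obtain ⟨a, b, hab⟩ := (hk k h).2.2
        exact ⟨a, b, fun _ => hab⟩
      · exact ⟨0, 0, fun h' => absurd h' h⟩
    choose a b hab using h1
    exact ⟨a, b, hab⟩
  obtain ⟨a, b, hab⟩ := hbez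
  -- The scalar identities `a ε + b ψ = 1` on the diagonal make `N` and `D` right coprime;
  -- substituting for `N` gives the identity for `X` and `D`.
  have hND : rectDiag m p a * U.1 * N + rectDiag m m b * (V⁻¹).1 * D = 1 := by
    rw [Matrix.mul_assoc, hUN, hD, Matrix.mul_assoc, ← Matrix.mul_assoc (V⁻¹).1, Units.inv_mul,
      Matrix.one_mul, rectDiag_mul_rectDiag hmp, rectDiag_mul_rectDiag le_rfl,
      ← rectDiag_eq_one hab]
    ext1 i j
    simp only [rectDiag, Matrix.add_apply, Matrix.of_apply]
    split_ifs
    · rfl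
    · exact add_zero 0
  refine ⟨N, D, X, rectDiag m p a * U.1 * S.C.map Polynomial.C,
    rectDiag m p a * U.1 * S.D.map Polynomial.C + rectDiag m m b * (V⁻¹).1, hUN, hDu, hZX, hNX, ?_⟩
  rw [Matrix.add_mul, ← add_assoc, Matrix.mul_assoc _ (S.C.map _), Matrix.mul_assoc _ (S.D.map _),
    ← Matrix.mul_add, ← hNX, hND]

/-- If `X D⁻¹` is a right coprime factorization of `(z I - A)⁻¹ B`, then polynomial solutions of
`(z I - A) a = B b` factor through `X` and `D`. -/
theorem factor_of_charmatrix_mul_eq {X : Matrix (Fin n) (Fin m) ℝ[X]}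
    {D Y : Matrix (Fin m) (Fin m) ℝ[X]} {Q : Matrix (Fin m) (Fin n) ℝ[X]}
    (hD : IsUnit (polyToRat D)) (hX : S.A.charmatrix * X = S.B.map Polynomial.C * D)
    (hQY : Q * X + Y * D = 1) {c : ℕ} {a : Matrix (Fin n) (Fin c) ℝ[X]}
    {b : Matrix (Fin m) (Fin c) ℝ[X]} (hab : S.A.charmatrix * a = S.B.map Polynomial.C * b) :
    X * (Q * a + Y * b) = a ∧ D * (Q * a + Y * b) = b := by
  -- The factor exists over rational functions as `D⁻¹ b`; `Q X + Y D = 1` shows that it is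
  -- polynomial.
  set l := (polyToRat D)⁻¹ * polyToRat b with hl
  have hDl : polyToRat D * l = polyToRat b := by
    rw [hl, ← Matrix.mul_assoc, Matrix.mul_nonsing_inv _ ((Matrix.isUnit_iff_isUnit_det _).1 hD),
      Matrix.one_mul]
  have hZ : IsUnit (polyToRat S.A.charmatrix) := by
    rw [polyToRat_charmatrix]
    exact isUnit_scalar_sub S.A
  clear_value l
  have hXl : polyToRat X * l = polyToRat a := by
    obtain ⟨Z, hZ⟩ := hZ
    have h1 : Z.1 * (polyToRat X * l) = Z.1 * polyToRat a := by
      rw [hZ, ← polyToRat_mul, hab, ← Matrix.mul_assoc, ← polyToRat_mul, hX, polyToRat_mul,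
        polyToRat_mul, Matrix.mul_assoc, hDl]
    have h2 := congrArg ((Z⁻¹).1 * ·) h1
    simpa only [← Matrix.mul_assoc, Units.inv_mul, Matrix.one_mul] using h2
  have hQYl : polyToRat (Q * a + Y * b) = l := by
    rw [polyToRat_add, polyToRat_mul, polyToRat_mul, ← hXl, ← hDl, ← Matrix.mul_assoc,
      ← Matrix.mul_assoc, ← Matrix.add_mul, ← polyToRat_mul, ← polyToRat_mul, ← polyToRat_add, hQY,
      polyToRat_one, Matrix.one_mul]
  constructor <;> apply polyToRat_injective
  · rw [polyToRat_mul, hQYl, hXl]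
  · rw [polyToRat_mul, hQYl, hDl]

/-- The number of finite zeros of the transfer matrix of a minimal system is the dimension of
the space of trajectories with zero output. -/
theorem eq_finrank_zeroOutputTrajectories_of_minimal {t ζ : ℕ} (hinv : S.IsDelayLeftInvertible t)
    (hobs : S.IsObservable) (hctr : S.IsControllable) (hζ : IsNumFiniteZeros S.transferMatrix ζ) :
    ζ = Module.finrank ℝ S.zeroOutputTrajectories := by
  obtain ⟨r, ε, ψ, hsm, rfl⟩ := hζ
  obtain rfl := hsm.rank_eq hinv.eq_zero_of_mulVec
  obtain ⟨hr, hk, -, U, V, hU, hV, hform⟩ := hsm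
  have hrp : r ≤ p := by omega
  rw [rectDiag_congr (fun k h => if_pos h)] at hform
  obtain ⟨N, D, X, Q, Y, hUN, hD, hZX, hN, hQY⟩ :=
    exists_coprime_factorization hobs hrp hk hU hV hform
  obtain ⟨R, T, hRT⟩ := hctr.exists_bezout
  rw [sum_card_aroots fun k h => (hk k h).1,
    ← finrank_ker_of_smith hrp hU isUnit_one (fun k h => (hk k h).1)
      ((Matrix.mul_one _).trans hUN)]
  -- By the controllability identity, the columns of `(1 - R Z, T Z)` and `(R B, 1 - T B)`, with `Z
  -- = z - A`, solve `Z a = B b`, hence factor through `(X, D)`.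
  obtain ⟨hX1, hD1⟩ := factor_of_charmatrix_mul_eq hD hZX hQY
    (a := 1 - R * S.A.charmatrix) (b := T * S.A.charmatrix) (by
      rw [Matrix.mul_sub, Matrix.mul_one, ← Matrix.mul_assoc, ← Matrix.mul_assoc,
        eq_sub_iff_add_eq'.2 hRT, Matrix.sub_mul, Matrix.one_mul])
  obtain ⟨hX2, hD2⟩ := factor_of_charmatrix_mul_eq hD hZX hQY
    (a := R * S.B.map Polynomial.C) (b := 1 - T * S.B.map Polynomial.C) (by
      rw [Matrix.mul_sub, Matrix.mul_one, ← Matrix.mul_assoc, ← Matrix.mul_assoc,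
        eq_sub_iff_add_eq.2 hRT, Matrix.sub_mul, Matrix.one_mul])
  let φ : LinearMap.ker (matAct seqAct N) →ₗ[ℝ] S.zeroOutputTrajectories :=
    LinearMap.codRestrict _
      (((matAct seqAct X).prod (matAct seqAct D)).comp (Submodule.subtype _)) fun l => by
        have h0 : matAct seqAct N l.1 = 0 := l.2
        refine S.mem_zeroOutputTrajectories.2 ⟨?_, ?_⟩
        · change matAct seqAct _ (matAct seqAct X l.1) = matAct seqAct _ (matAct seqAct D l.1)
          rw [← matAct_mul, ← matAct_mul, hZX]
        · change matAct seqAct _ (matAct seqAct X l.1) +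
            matAct seqAct _ (matAct seqAct D l.1) = 0
          rw [← matAct_mul, ← matAct_mul, ← matAct_add, ← hN, h0]
  refine (LinearEquiv.ofBijective φ ⟨?_, ?_⟩).finrank_eq
  · rw [← LinearMap.ker_eq_bot, LinearMap.ker_eq_bot']
    intro l hl
    have hl1 : matAct seqAct X l.1 = 0 := congrArg (fun w => w.1.1) hl
    have hl2 : matAct seqAct D l.1 = 0 := congrArg (fun w => w.1.2) hl
    ext1
    rw [← matAct_one seqAct l.1, ← hQY, matAct_add, matAct_mul, matAct_mul, hl1, hl2, map_zero,
      map_zero, add_zero]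
    rfl
  · rintro ⟨⟨x, f⟩, hxf⟩
    obtain ⟨h1, h2⟩ := S.mem_zeroOutputTrajectories.1 hxf
    simp only at h1 h2
    -- On a trajectory `Z x = B f`, so the two solution matrices applied to `x` and `f` add up to
    -- `(x, f)`; their factors therefore give a preimage.
    set l := matAct seqAct (Q * (1 - R * S.A.charmatrix) + Y * (T * S.A.charmatrix)) x +
      matAct seqAct (Q * (R * S.B.map Polynomial.C) + Y * (1 - T * S.B.map Polynomial.C)) f with hl
    have hXl : matAct seqAct X l = x := by
      rw [hl, map_add, ← matAct_mul, ← matAct_mul, hX1, hX2, matAct_sub, matAct_one, matAct_mul,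
        matAct_mul, h1, sub_add_cancel]
    have hDl : matAct seqAct D l = f := by
      rw [hl, map_add, ← matAct_mul, ← matAct_mul, hD1, hD2, matAct_sub, matAct_one, matAct_mul,
        matAct_mul, h1, add_sub_cancel]
    refine ⟨⟨l, ?_⟩, ?_⟩
    · rw [LinearMap.mem_ker, hN, matAct_add, matAct_mul, matAct_mul, hXl, hDl, h2]
    · exact Subtype.ext (Prod.ext hXl hDl)

end LTISystem

theorem mainTheorem2 {n m p : ℕ} (S : LTISystem n m p) (hobs : S.IsObservable)
    (τ : ℕ) (hτ : IsLeast {t : ℕ | S.IsDelayLeftInvertible t} τ)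
    (L : ℕ) (hL : max τ n ≤ L)
    (ζinf : ℕ) (hinf : IsNumInfiniteZeros S.transferMatrix ζinf) :
    (∀ ζfi : ℕ, IsNumFiniteZeros S.systemMatrix ζfi →
      S.obsToeplitzNullity L = ζfi + ζinf) ∧
    (S.IsControllable → ∀ ζfi : ℕ, IsNumFiniteZeros S.transferMatrix ζfi →
      S.obsToeplitzNullity L = ζfi + ζinf) := by
  have hinv : S.IsDelayLeftInvertible τ := hτ.1
  have hnull : S.obsToeplitzNullity L =
      Module.finrank ℝ S.zeroOutputTrajectories + ζinf := by
    rw [S.obsToeplitzNullity_eq_add ((le_max_right _ _).trans hL),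
      hinv.finrank_zeroOutputTrajectories,
      ← hinv.eq_finrank_ker_of_infinite ((le_max_left _ _).trans hL) hinf]
  refine ⟨fun ζ hζ => ?_, fun hctr ζ hζ => ?_⟩
  · rw [← S.polyToRat_systemPoly] at hζ
    rw [hnull, hζ.eq_finrank_ker, S.finrank_ker_systemPoly]
    rw [S.polyToRat_systemPoly]
    exact hinv.eq_zero_of_systemMatrix_mulVec
  · rw [hnull, LTISystem.eq_finrank_zeroOutputTrajectories_of_minimal hinv hobs hctr hζ]
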